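/- Consider a network of vehicles in $\mathbb R^2$. Vehicle $v$ has lane-center point $x^L_v$, lane deviation $x^D_v$, GNSS common error $x^C$ (the same for all vehicles), non-common error $x^N_v$ and GNSS position $x^G_v=x^L_v+x^D_v+x^C+x^N_v$; its composite non-common error is $\tilde x_v=x^D_v+x^N_v$. Its road has unit normal $n_v$, and the lanes have half width $w$. The approximate feasible set of the common error is $$\Omega=\{\tau:\ (x^G_v-\tau-x^L_v)\cdot n_v-w<0\ \text{ for all } v\},$$ the estimate of the common error is the average $\hat x^C=\frac1S\int_\Omega\tau\,dA$, $S=\int_\Omega dA$, and the CMM error is $e=x^C-\hat x^C$, with $e^2=\|e\|^2$. Let the roads run in the four directions $\theta_j=(j-1)\pi/2$, $j=1,2,3,4$, with $N_j\ge1$ vehicles driving in direction $j$; let $n_j$ be the unit normal pointing to the right of direction $\theta_j$, and let $X_j=\max\{\tilde x_v\cdot n_j:\ v \text{ drives in direction } j\}$. (a) Whenever $\Omega$ is non-empty, $0<S<\infty$ and $$e^2=Q:=\frac{X_1^2+X_2^2+X_3^2+X_4^2-2X_1X_3-2X_2X_4}{4}.$$ (b) Take a sequence of such random networks, with parameters $N_j,w,\sigma$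 that may vary along the sequence ($\sigma>0$; constant $w$ and $\sigma$ are allowed), in each of which all the composite errors $\tilde x_v$ are independent with the same centered Gaussian law on $\mathbb R^2$ having variance $\sigma^2$ along each of the two road axes. Let all $N_j\to\infty$, with $N_1/N_3\to1$ and $N_2/N_4\to1$ (as is the case when the four numbers are asymptotically equal). Then $Q$ is integrable and $$E[Q]\ \sim\ \frac{\pi^2\sigma^2}{48}\sum_{j=1}^4\frac1{\log N_j}.$$ If moreover $P(\Omega\neq\emptyset)\to1$, then (for all but finitely many members of the sequence $e^2$ is integrable given $\Omega\ne\emptyset$, and) also $$E\big[e^2\,\big|\,\Omega\neq\emptyset\big]\ \sim\ \frac{\pi^2\sigma^2}{48}\sum_{j=1}^4\frac1{\log N_j}.$$ -/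

import Mathlib

open Filter Topology MeasureTheory ProbabilityTheory Asymptotics

/-- The plane in which the vehicles travel, with its Euclidean norm and area measure. -/
abbrev Plane : Type := EuclideanSpace ℝ (Fin 2)

noncomputable section

/-- Positions and errors of a network of vehicles, indexed by `ι`. -/
structure VehicleNetwork (ι : Type*) where
  /-- point `x^L` on the lane center corresponding to each vehicle -/
  laneCenter : ι → Plane
  /-- deviation `x^D` of each vehicle from its lane center point -/
  deviation : ι → Plane
  /-- GNSS common error `x^C`, the same for all vehicles -/
  commonError : Plane
  /-- GNSS non-common error `x^N` of each vehicle -/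
  nonCommonError : ι → Plane

namespace VehicleNetwork

variable {ι : Type*}

/-- GNSS position `x^G = x^L + x^D + x^C + x^N`. -/
def gnss (V : VehicleNetwork ι) (v : ι) : Plane :=
  V.laneCenter v + V.deviation v + V.commonError + V.nonCommonError v

/-- Composite non-common error `x^D + x^N`. -/
def composite (V : VehicleNetwork ι) (v : ι) : Plane :=
  V.deviation v + V.nonCommonError v

/-- Road constraint function `g_v(x) = (x - x^L_v) · n_v - w`, where `n` gives the unit normals of
the roads and `w` is the half width of the lanes. -/
def constraint (V : VehicleNetwork ι) (n : ι → Plane) (w : ℝ) (v : ι) (x : Plane) : ℝ :=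
  inner ℝ (x - V.laneCenter v) (n v) - w

/-- Approximate feasible set of the common error: all `τ` such that every GNSS position corrected
by `τ` satisfies its road constraint. -/
def feasibleSet (V : VehicleNetwork ι) (n : ι → Plane) (w : ℝ) : Set Plane :=
  {τ | ∀ v, V.constraint n w v (V.gnss v - τ) < 0}

/-- The estimated common error: the average `(1 / S) ∫ τ dA` over the feasible set. -/
def estimate (V : VehicleNetwork ι) (n : ι → Plane) (w : ℝ) : Plane :=
  ⨍ τ in V.feasibleSet n w, τ

/-- The cooperative map matching error: true minus estimated common error. -/
def cmmError (V : VehicleNetwork ι) (n : ι → Plane) (w : ℝ) : Plane :=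
  V.commonError - V.estimate n w

end VehicleNetwork

/-- Unit normal, pointing to the right of the driving direction `(cos θ, sin θ)`. -/
def roadNormal (θ : ℝ) : Plane := !₂[Real.sin θ, -Real.cos θ]

/-- The four orthogonal driving directions `0, π/2, π, 3π/2`. -/
def orthAngle (j : Fin 4) : ℝ := (j : ℕ) * (Real.pi / 2)

/-- Vehicles on orthogonal roads, `N j` of them driving in the `j`-th direction. -/
abbrev OrthVehicle (N : Fin 4 → ℕ) : Type := Σ j : Fin 4, Fin (N j)

/-- The road normal of each vehicle on orthogonal roads. -/
def orthNormal {N : Fin 4 → ℕ} (v : OrthVehicle N) : Plane := roadNormal (orthAngle v.1)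

/-- `X j`: the largest projection on the `j`-th normal of the composite non-common errors of the
vehicles driving in the `j`-th direction (a maximum as soon as `0 < N j`). -/
def maxProjection {N : Fin 4 → ℕ} (V : VehicleNetwork (OrthVehicle N)) (j : Fin 4) : ℝ :=
  ⨆ i : Fin (N j), inner ℝ (V.composite ⟨j, i⟩) (roadNormal (orthAngle j))

/-- `(X₁² + X₂² + X₃² + X₄² - 2 X₁ X₃ - 2 X₂ X₄) / 4`, with the directions numbered from `0`. -/
def orthSquareError (X : Fin 4 → ℝ) : ℝ :=
  ((∑ j, X j ^ 2) - 2 * X 0 * X 2 - 2 * X 1 * X 3) / 4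

end

/-! The four normals are plus or minus the coordinate vectors, so a non-empty feasible set is an
open rectangle with sides parallel to the axes. Its barycenter is its center, and comparing the
center with the common error gives `e² = ((X₁ - X₃)² + (X₂ - X₄)²) / 4`.

For the expectation, each `X_j / σ` is the maximum of `N_j` independent standard Gaussians, and
maxima in different directions are independent. Let `b_n` be the level exceeded with probability `1
/ n`. Elementary shift bounds on the Gaussian tail (`gaussianTail_add_le`, `le_gaussianTail_add`)
give `b_n² ~ 2 log n` and `n P(Z > b_n + y / b_n) → exp (-y)`, so `b_n (M_n - b_n)` converges to a
Gumbel law. If `m / n → 1`, then `b_m (b_m - b_n) → 0`, and `b_m (M_m - M_n)` converges to a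
difference of two independent Gumbel variables. This difference is logistic, with second moment `π²
/ 3` (`integral_gumbelQuantile_sub_sq`).

To pass to moments, the maxima are replaced by their quantile functions at independent uniform
variables. Convergence is then pointwise, and `abs_scaledQuantile_le` supplies a dominating function
in `L⁴`. Second moments converge, whence `E (X₁ - X₃)² ~ σ² (π² / 3) / (2 log N₁)`; symmetrizing in
the two directions and adding the other pair gives the constant `π² / 48`. Bounded fourth moments
make events of vanishing probability negligible, which settles the conditional version. -/

/-! ### The feasible rectangle and its barycenter -/

theorem inner_roadNormal_zero (x : Plane) : inner ℝ x (roadNormal (orthAngle 0)) = -x 1 := by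
  simp [roadNormal, orthAngle, PiLp.inner_apply]

theorem inner_roadNormal_one (x : Plane) : inner ℝ x (roadNormal (orthAngle 1)) = x 0 := by
  simp [roadNormal, orthAngle, PiLp.inner_apply]

theorem inner_roadNormal_two (x : Plane) : inner ℝ x (roadNormal (orthAngle 2)) = x 1 := by
  have h : orthAngle 2 = Real.pi := by simp only [orthAngle, Fin.val_two]; push_cast; ring
  simp [h, roadNormal, PiLp.inner_apply]

theorem inner_roadNormal_three (x : Plane) : inner ℝ x (roadNormal (orthAngle 3)) = -x 0 := by
  have h : orthAngle 3 = Real.pi / 2 + Real.pi := by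
    have : ((3 : Fin 4) : ℕ) = 3 := rfl
    simp only [orthAngle, this]; push_cast; ring
  simp [h, roadNormal, PiLp.inner_apply, Real.sin_add, Real.cos_add]

theorem ciSup_add_lt_iff {ι : Type*} [Finite ι] [Nonempty ι] (f : ι → ℝ) (a w : ℝ) :
    (⨆ i, f i) + a < w ↔ ∀ i, f i + a < w := by
  constructor
  · intro h i
    linarith [le_ciSup (Set.finite_range f).bddAbove i]
  · intro h
    obtain ⟨i, hi⟩ := exists_eq_ciSup_of_finite (f := f)
    rw [← hi]; exact h i

namespace VehicleNetwork

variable {N : Fin 4 → ℕ} (V : VehicleNetwork (OrthVehicle N)) (w : ℝ)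

theorem mem_feasibleSet_iff_maxProjection (hN : ∀ j, 0 < N j) (τ : Plane) :
    τ ∈ V.feasibleSet orthNormal w ↔
      ∀ j, maxProjection V j + inner ℝ (V.commonError - τ) (roadNormal (orthAngle j)) < w := by
  rw [feasibleSet, Set.mem_ofPred_eq, Sigma.forall]
  refine forall_congr' fun j => ?_
  have : Nonempty (Fin (N j)) := ⟨⟨0, hN j⟩⟩
  rw [maxProjection, ciSup_add_lt_iff]
  refine forall_congr' fun i => ?_
  rw [← inner_add_left, constraint, sub_neg]
  simp only [gnss, composite, orthNormal]
  rw [iff_iff_eq]; congr 2; abel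

/-- Opposite directions bound the same coordinate from its two sides, so the conditions decouple
into one interval per coordinate. -/
theorem mem_feasibleSet_iff (hN : ∀ j, 0 < N j) (τ : Plane) :
    τ ∈ V.feasibleSet orthNormal w ↔
      (maxProjection V 0 - (V.commonError 1 - τ 1) < w ∧
        maxProjection V 2 + (V.commonError 1 - τ 1) < w) ∧
      (maxProjection V 3 - (V.commonError 0 - τ 0) < w ∧
        maxProjection V 1 + (V.commonError 0 - τ 0) < w) := by
  rw [mem_feasibleSet_iff_maxProjection V w hN, Fin.forall_fin_succ, Fin.forall_fin_succ,
    Fin.forall_fin_succ, Fin.forall_fin_one]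
  change _ ∧ _ + inner ℝ _ (roadNormal (orthAngle 1)) < w ∧
    _ + inner ℝ _ (roadNormal (orthAngle 2)) < w ∧
    _ + inner ℝ _ (roadNormal (orthAngle 3)) < w ↔ _
  rw [inner_roadNormal_zero, inner_roadNormal_one, inner_roadNormal_two, inner_roadNormal_three]
  simp only [PiLp.sub_apply, ← sub_eq_add_neg]
  change _ ∧ maxProjection V 1 + _ < w ∧ maxProjection V 2 + _ < w ∧ maxProjection V 3 - _ < w ↔ _
  tauto

theorem feasibleSet_nonempty_iff (hN : ∀ j, 0 < N j) :
    (V.feasibleSet orthNormal w).Nonempty ↔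
      maxProjection V 0 + maxProjection V 2 < 2 * w ∧
      maxProjection V 1 + maxProjection V 3 < 2 * w := by
  constructor
  · rintro ⟨τ, hτ⟩
    obtain ⟨⟨h0, h2⟩, h3, h1⟩ := (V.mem_feasibleSet_iff w hN τ).1 hτ
    constructor <;> linarith
  · rintro ⟨h, h'⟩
    -- The center of the rectangle: the midpoint of the two bounds on each coordinate.
    refine ⟨V.commonError - !₂[(maxProjection V 3 - maxProjection V 1) / 2,
      (maxProjection V 0 - maxProjection V 2) / 2], ?_⟩
    rw [V.mem_feasibleSet_iff w hN]
    simp only [PiLp.sub_apply, Matrix.cons_val_zero, Matrix.cons_val_one]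
    refine ⟨⟨?_, ?_⟩, ?_, ?_⟩ <;> linarith

theorem isOpen_feasibleSet (hN : ∀ j, 0 < N j) : IsOpen (V.feasibleSet orthNormal w) := by
  have h : V.feasibleSet orthNormal w = {τ : Plane |
      (maxProjection V 0 - (V.commonError 1 - τ 1) < w ∧
        maxProjection V 2 + (V.commonError 1 - τ 1) < w) ∧
      (maxProjection V 3 - (V.commonError 0 - τ 0) < w ∧
        maxProjection V 1 + (V.commonError 0 - τ 0) < w)} :=
    Set.ext (V.mem_feasibleSet_iff w hN)
  rw [h]
  refine IsOpen.and (IsOpen.and ?_ ?_) (IsOpen.and ?_ ?_) <;>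
    exact isOpen_lt (by fun_prop) continuous_const

theorem isBounded_feasibleSet (hN : ∀ j, 0 < N j) :
    Bornology.IsBounded (V.feasibleSet orthNormal w) := by
  have h : Bornology.IsBounded (WithLp.ofLp '' (V.feasibleSet orthNormal w)) := by
    refine (Metric.isBounded_Icc
      ![maxProjection V 1 + V.commonError 0 - w, maxProjection V 2 + V.commonError 1 - w]
      ![w - maxProjection V 3 + V.commonError 0, w - maxProjection V 0 + V.commonError 1]).subset ?_
    rintro _ ⟨τ, hτ, rfl⟩
    obtain ⟨⟨h0, h2⟩, h3, h1⟩ := (V.mem_feasibleSet_iff w hN τ).1 hτ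
    refine ⟨fun i => ?_, fun i => ?_⟩ <;> fin_cases i <;> simp <;> linarith
  have := (PiLp.lipschitzWith_toLp (p := 2) (fun _ : Fin 2 => ℝ)).isBounded_image h
  rw [Set.image_image] at this
  simpa using this

end VehicleNetwork

/-- The barycenter of a bounded set of positive volume which is symmetric about `c` is `c`. -/
theorem setAverage_eq_of_symm {s : Set Plane} {c : Plane} (hs : MeasurableSet s)
    (hb : Bornology.IsBounded s) (h0 : volume s ≠ 0) (hsymm : ∀ τ, τ ∈ s ↔ c + c - τ ∈ s) :
    ⨍ τ in s, τ = c := by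
  have hfin : volume s < ⊤ := hb.measure_lt_top
  obtain ⟨R, hR⟩ := hb.exists_norm_le
  have hint : IntegrableOn (fun τ : Plane => τ) s :=
    Measure.integrableOn_of_bounded (M := R) hfin.ne (by fun_prop)
      ((ae_restrict_iff' hs).2 (.of_forall hR))
  have hmp : MeasurePreserving (fun τ : Plane => c + c - τ) volume volume :=
    Measure.measurePreserving_sub_left volume (c + c)
  have hpre : (fun τ : Plane => c + c - τ) ⁻¹' s = s := by
    ext τ; exact (hsymm τ).symm
  -- The reflection in `c` preserves both area and `s`; this identity therefore forces twice the
  -- integral to be `2 |s| c`.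
  have h1 : ∫ τ in s, (c + c - τ) = ∫ τ in s, τ := by
    have := hmp.setIntegral_preimage_emb
      (MeasurableEquiv.subLeft (c + c)).measurableEmbedding (fun τ => τ) s
    rwa [hpre] at this
  have hc : IntegrableOn (fun _ : Plane => c + c) s := integrableOn_const hfin.ne
  rw [integral_sub hc hint, setIntegral_const] at h1
  have hr : volume.real s ≠ 0 := (measureReal_ne_zero_iff hfin.ne).2 h0
  have h2 : (2 : ℝ) • ∫ τ in s, τ = (2 : ℝ) • volume.real s • c := by
    rw [two_smul, eq_sub_iff_add_eq.1 h1.symm, smul_add, two_smul]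
  rw [setAverage_eq, smul_right_injective Plane (two_ne_zero' ℝ) h2, smul_smul,
    inv_mul_cancel₀ hr, one_smul]

namespace VehicleNetwork

variable {N : Fin 4 → ℕ} (V : VehicleNetwork (OrthVehicle N)) (w : ℝ)

theorem volume_feasibleSet_pos (hN : ∀ j, 0 < N j) (h : (V.feasibleSet orthNormal w).Nonempty) :
    0 < volume (V.feasibleSet orthNormal w) :=
  (V.isOpen_feasibleSet w hN).measure_pos volume h

theorem estimate_eq (hN : ∀ j, 0 < N j) (h : (V.feasibleSet orthNormal w).Nonempty) :
    V.estimate orthNormal w = V.commonError - !₂[(maxProjection V 3 - maxProjection V 1) / 2,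
      (maxProjection V 0 - maxProjection V 2) / 2] := by
  refine setAverage_eq_of_symm (V.isOpen_feasibleSet w hN).measurableSet
    (V.isBounded_feasibleSet w hN) (V.volume_feasibleSet_pos w hN h).ne' fun τ => ?_
  rw [V.mem_feasibleSet_iff w hN, V.mem_feasibleSet_iff w hN]
  simp only [PiLp.sub_apply, PiLp.add_apply, Matrix.cons_val_zero, Matrix.cons_val_one]
  constructor <;> rintro ⟨⟨h0, h2⟩, h3, h1⟩ <;> refine ⟨⟨?_, ?_⟩, ?_, ?_⟩ <;> linarith

theorem norm_cmmError_sq (hN : ∀ j, 0 < N j) (h : (V.feasibleSet orthNormal w).Nonempty) :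
    ‖V.cmmError orthNormal w‖ ^ 2 = orthSquareError (maxProjection V) := by
  rw [cmmError, V.estimate_eq w hN h, sub_sub_cancel, EuclideanSpace.norm_sq_eq, Fin.sum_univ_two,
    orthSquareError, Fin.sum_univ_four]
  simp only [Matrix.cons_val_zero, Matrix.cons_val_one, Real.norm_eq_abs, sq_abs]
  ring

end VehicleNetwork

/-! ### Shift bounds for the Gaussian tail -/

/-- The tail `P(Z > x)` of a standard Gaussian variable. -/
noncomputable def gaussianTail (x : ℝ) : ℝ := (gaussianReal 0 1).real (Set.Ioi x)

theorem gaussianTail_eq_integral (x : ℝ) :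
    gaussianTail x = ∫ t in Set.Ioi x, gaussianPDFReal 0 1 t := by
  rw [gaussianTail, Measure.real, gaussianReal_apply_eq_integral 0 one_ne_zero,
    ENNReal.toReal_ofReal (integral_nonneg fun t => gaussianPDFReal_nonneg 0 1 t)]

theorem gaussianPDFReal_add_eq_mul_exp (t d : ℝ) :
    gaussianPDFReal 0 1 (t + d) = gaussianPDFReal 0 1 t * Real.exp (-(t * d) - d ^ 2 / 2) := by
  simp only [gaussianPDFReal, NNReal.coe_one]
  rw [mul_assoc (√_)⁻¹, ← Real.exp_add]
  congr 2
  ring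

theorem gaussianTail_add (x d : ℝ) :
    gaussianTail (x + d) =
      ∫ t in Set.Ioi x, gaussianPDFReal 0 1 t * Real.exp (-(t * d) - d ^ 2 / 2) := by
  have := (measurePreserving_add_right volume d).setIntegral_preimage_emb
    (MeasurableEquiv.addRight d).measurableEmbedding (gaussianPDFReal 0 1) (Set.Ioi (x + d))
  rw [gaussianTail_eq_integral, ← this]
  simp [gaussianPDFReal_add_eq_mul_exp]

theorem integrableOn_gaussianPDFReal_mul_exp (s : Set ℝ) (d : ℝ) :
    IntegrableOn (fun t => gaussianPDFReal 0 1 t * Real.exp (-(t * d) - d ^ 2 / 2)) s := by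
  simp_rw [← gaussianPDFReal_add_eq_mul_exp]
  exact ((integrable_gaussianPDFReal 0 1).comp_add_right d).integrableOn

theorem gaussianTail_nonneg (x : ℝ) : 0 ≤ gaussianTail x := measureReal_nonneg

/-- Translating the density by `d` multiplies it by `exp (-t d - d² / 2)`, which on `t > x` is
largest at the endpoint. This bound and the next one take the place of the tail asymptotics. -/
theorem gaussianTail_add_le (x : ℝ) {d : ℝ} (hd : 0 ≤ d) :
    gaussianTail (x + d) ≤ gaussianTail x * Real.exp (-(x * d) - d ^ 2 / 2) := by
  rw [gaussianTail_add, gaussianTail_eq_integral, ← integral_mul_const]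
  refine setIntegral_mono_on (integrableOn_gaussianPDFReal_mul_exp _ d)
    ((integrable_gaussianPDFReal 0 1).mul_const _).integrableOn measurableSet_Ioi fun t ht => ?_
  have : x * d ≤ t * d := mul_le_mul_of_nonneg_right (le_of_lt ht) hd
  have := gaussianPDFReal_nonneg 0 1 t
  gcongr

/-- Only the part `(x, x + 1]` of the integral is kept, where the shift factor is at least its value
at `x + 1`. The mass given up is controlled by the upper bound with `d = 1`. -/
theorem le_gaussianTail_add (x : ℝ) {d : ℝ} (hd : 0 ≤ d) :
    gaussianTail x * (1 - Real.exp (-x - 1 / 2)) * Real.exp (-((x + 1) * d) - d ^ 2 / 2) ≤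
      gaussianTail (x + d) := by
  have h1 : gaussianTail (x + 1) ≤ gaussianTail x * Real.exp (-x - 1 / 2) := by
    simpa using gaussianTail_add_le x zero_le_one
  have hI : ∀ s, IntegrableOn (gaussianPDFReal 0 1) s := fun s =>
    (integrable_gaussianPDFReal 0 1).integrableOn
  have h2 : gaussianTail x - gaussianTail (x + 1) =
      ∫ t in Set.Ioc x (x + 1), gaussianPDFReal 0 1 t := by
    rw [gaussianTail_eq_integral, gaussianTail_eq_integral, sub_eq_iff_eq_add,
      ← setIntegral_union (Set.Ioc_disjoint_Ioi le_rfl) measurableSet_Ioi (hI _) (hI _),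
      Set.Ioc_union_Ioi_eq_Ioi (by linarith)]
  calc gaussianTail x * (1 - Real.exp (-x - 1 / 2)) * Real.exp (-((x + 1) * d) - d ^ 2 / 2)
      ≤ (gaussianTail x - gaussianTail (x + 1)) * Real.exp (-((x + 1) * d) - d ^ 2 / 2) := by
        gcongr; linarith
    _ = ∫ t in Set.Ioc x (x + 1),
          gaussianPDFReal 0 1 t * Real.exp (-((x + 1) * d) - d ^ 2 / 2) := by
        rw [h2, integral_mul_const]
    _ ≤ ∫ t in Set.Ioc x (x + 1), gaussianPDFReal 0 1 t * Real.exp (-(t * d) - d ^ 2 / 2) := by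
        refine setIntegral_mono_on ((hI _).mul_const _)
          (integrableOn_gaussianPDFReal_mul_exp _ d) measurableSet_Ioc fun t ht => ?_
        have : t * d ≤ (x + 1) * d := mul_le_mul_of_nonneg_right ht.2 hd
        have := gaussianPDFReal_nonneg 0 1 t
        gcongr
    _ ≤ ∫ t in Set.Ioi x, gaussianPDFReal 0 1 t * Real.exp (-(t * d) - d ^ 2 / 2) :=
        setIntegral_mono_set (integrableOn_gaussianPDFReal_mul_exp _ d)
          (.of_forall fun t => mul_nonneg (gaussianPDFReal_nonneg 0 1 t) (Real.exp_pos _).le)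
          (.of_forall Set.Ioc_subset_Ioi_self)
    _ = gaussianTail (x + d) := (gaussianTail_add x d).symm

theorem cdf_gaussianReal_eq (x : ℝ) : cdf (gaussianReal 0 1) x = 1 - gaussianTail x := by
  rw [cdf_eq_real, gaussianTail, ← Set.compl_Iic, probReal_compl_eq_one_sub measurableSet_Iic]
  ring

theorem gaussianTail_le_one (x : ℝ) : gaussianTail x ≤ 1 := measureReal_le_one

theorem gaussianTail_antitone : Antitone gaussianTail := fun _ _ h =>
  measureReal_mono (Set.Ioi_subset_Ioi h)

theorem gaussianTail_neg (x : ℝ) : gaussianTail (-x) = 1 - gaussianTail x := by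
  have := nullSingletonClass_gaussianReal (μ := 0) (one_ne_zero (α := NNReal))
  have hm : Measure.map (fun x : ℝ => -x) (gaussianReal 0 1) = gaussianReal 0 1 := by
    rw [gaussianReal_map_neg, neg_zero]
  rw [← cdf_gaussianReal_eq, cdf_eq_real, gaussianTail, ← hm,
    map_measureReal_apply measurable_neg measurableSet_Ioi, hm]
  have : (fun x : ℝ => -x) ⁻¹' Set.Ioi (-x) = Set.Iio x := by ext; simp
  rw [this]
  exact measureReal_congr Iio_ae_eq_Iic

theorem gaussianTail_zero : gaussianTail 0 = 1 / 2 := by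
  have := gaussianTail_neg 0
  rw [neg_zero] at this
  linarith

theorem gaussianTail_pos (x : ℝ) : 0 < gaussianTail x := by
  rw [gaussianTail_eq_integral, setIntegral_pos_iff_support_of_nonneg_ae]
  · have : Function.support (gaussianPDFReal 0 1) = Set.univ := by
      ext t; simpa using (gaussianPDFReal_pos 0 1 t one_ne_zero).ne'
    simp [this]
  · exact .of_forall fun t => gaussianPDFReal_nonneg 0 1 t
  · exact (integrable_gaussianPDFReal 0 1).integrableOn

theorem continuous_gaussianTail : Continuous gaussianTail := by
  have := nullSingletonClass_gaussianReal (μ := 0) (one_ne_zero (α := NNReal))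
  have h : gaussianTail = fun x => 1 - cdf (gaussianReal 0 1) x := by
    ext x; rw [cdf_gaussianReal_eq]; ring
  rw [h]
  refine continuous_const.sub (continuous_iff_continuousAt.2 fun x => ?_)
  have h1 := (cdf (gaussianReal 0 1)).measure_singleton x
  rw [measure_cdf, measure_singleton, eq_comm, ENNReal.ofReal_eq_zero, sub_nonpos] at h1
  rw [continuousAt_iff_continuous_left'_right']
  refine ⟨?_, ((cdf (gaussianReal 0 1)).right_continuous x).mono Set.Ioi_subset_Ici_self⟩
  rw [(monotone_cdf _).continuousWithinAt_Iio_iff_leftLim_eq]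
  exact le_antisymm ((monotone_cdf _).leftLim_le le_rfl) h1

theorem gaussianTail_le_half_exp {d : ℝ} (hd : 0 ≤ d) :
    gaussianTail d ≤ 1 / 2 * Real.exp (-d ^ 2 / 2) := by
  simpa [gaussianTail_zero, neg_div] using gaussianTail_add_le 0 hd

theorem tendsto_gaussianTail_atTop : Tendsto gaussianTail atTop (𝓝 0) := by
  have h : gaussianTail = fun x => 1 - cdf (gaussianReal 0 1) x := by
    ext x; rw [cdf_gaussianReal_eq]; ring
  rw [h]
  simpa using (tendsto_cdf_atTop (gaussianReal 0 1)).const_sub 1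

theorem exists_gaussianTail_eq {n : ℕ} (hn : 2 ≤ n) :
    ∃ b, 0 ≤ b ∧ gaussianTail b = 1 / n := by
  have hn' : (2 : ℝ) ≤ n := by exact_mod_cast hn
  have hpos : (0 : ℝ) < 1 / n := by positivity
  obtain ⟨c, hc, hc0⟩ :=
    ((tendsto_gaussianTail_atTop.eventually (gt_mem_nhds hpos)).and (eventually_ge_atTop 0)).exists
  obtain ⟨b, hb, hb'⟩ := intermediate_value_Icc' hc0 continuous_gaussianTail.continuousOn
    (show (1 / n : ℝ) ∈ Set.Icc (gaussianTail c) (gaussianTail 0) from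
      ⟨hc.le, by rw [gaussianTail_zero]; gcongr⟩)
  exact ⟨b, hb.1, hb'⟩

/-! ### The levels `b_n` and the Gumbel limit -/

/-- The level exceeded by a standard Gaussian variable with probability `1 / n`. -/
noncomputable def gaussianLevel (n : ℕ) : ℝ :=
  if hn : 2 ≤ n then (exists_gaussianTail_eq hn).choose else 0

theorem gaussianLevel_nonneg (n : ℕ) : 0 ≤ gaussianLevel n := by
  rw [gaussianLevel]
  split_ifs with hn
  · exact (exists_gaussianTail_eq hn).choose_spec.1
  · exact le_rfl

theorem gaussianTail_gaussianLevel {n : ℕ} (hn : 2 ≤ n) :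
    gaussianTail (gaussianLevel n) = 1 / n := by
  rw [gaussianLevel, dif_pos hn]
  exact (exists_gaussianTail_eq hn).choose_spec.2

theorem tendsto_gaussianLevel : Tendsto gaussianLevel atTop atTop := by
  refine tendsto_atTop.2 fun M => ?_
  have h := tendsto_one_div_atTop_nhds_zero_nat.eventually (gt_mem_nhds (gaussianTail_pos M))
  filter_upwards [h, eventually_ge_atTop 2] with n hn hn2
  by_contra! hlt
  rw [← gaussianTail_gaussianLevel hn2] at hn
  exact absurd (gaussianTail_antitone hlt.le) hn.not_ge

theorem le_log_of_gaussianLevel {n : ℕ} (hn : 2 ≤ n) :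
    gaussianLevel n ^ 2 / 2 + Real.log 2 ≤ Real.log n := by
  have h := gaussianTail_le_half_exp (gaussianLevel_nonneg n)
  have hn0 : (0 : ℝ) < n := by positivity
  rw [gaussianTail_gaussianLevel hn] at h
  have h2 := Real.log_le_log (by positivity) h
  rw [Real.log_mul (by norm_num) (Real.exp_pos _).ne', Real.log_exp, one_div, one_div, Real.log_inv,
    Real.log_inv] at h2
  linarith

/-- The lower shift bound from `0` to `b_n` loses only a term linear in `b_n`, negligible against
`b_n² / 2`. -/
theorem log_le_of_gaussianLevel {n : ℕ} (hn : 2 ≤ n) :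
    Real.log n ≤ gaussianLevel n ^ 2 / 2 + gaussianLevel n -
      Real.log (1 / 2 * (1 - Real.exp (-1 / 2))) := by
  have h := le_gaussianTail_add 0 (gaussianLevel_nonneg n)
  have hn0 : (0 : ℝ) < n := by positivity
  have he : 0 < 1 - Real.exp (-1 / 2) := by
    have : Real.exp (-1 / 2) < 1 :=
      (Real.exp_lt_exp.2 (by norm_num)).trans_eq Real.exp_zero
    linarith
  rw [zero_add, zero_add, gaussianTail_gaussianLevel hn, gaussianTail_zero, neg_zero, one_mul,
    zero_sub, ← neg_div] at h
  have h2 := Real.log_le_log (by positivity) h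
  rw [Real.log_mul (by positivity) (Real.exp_pos _).ne', Real.log_exp, one_div (n : ℝ),
    Real.log_inv] at h2
  linarith

theorem tendsto_log_div_gaussianLevel_sq :
    Tendsto (fun n : ℕ => Real.log n / gaussianLevel n ^ 2) atTop (𝓝 (1 / 2)) := by
  set c := Real.log (1 / 2 * (1 - Real.exp (-1 / 2)))
  have hinv : Tendsto (fun n => (gaussianLevel n)⁻¹) atTop (𝓝 0) :=
    tendsto_inv_atTop_zero.comp tendsto_gaussianLevel
  have hup : Tendsto (fun n => 1 / 2 + (gaussianLevel n)⁻¹ - c * (gaussianLevel n)⁻¹ ^ 2) atTop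
      (𝓝 (1 / 2)) := by
    simpa only [add_zero, ne_eq, OfNat.ofNat_ne_zero, not_false_eq_true, zero_pow, mul_zero,
      sub_zero] using (hinv.const_add (1 / 2)).sub ((hinv.pow 2).const_mul c)
  refine tendsto_of_tendsto_of_tendsto_of_le_of_le' tendsto_const_nhds hup ?_ ?_ <;>
    filter_upwards [tendsto_gaussianLevel.eventually_gt_atTop 0, eventually_ge_atTop 2]
      with n hb hn
  · rw [le_div_iff₀ (by positivity)]
    linarith [le_log_of_gaussianLevel hn, Real.log_pos one_lt_two]
  · rw [div_le_iff₀ (by positivity)]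
    have := log_le_of_gaussianLevel hn
    have h1 : (gaussianLevel n)⁻¹ * gaussianLevel n = 1 := inv_mul_cancel₀ hb.ne'
    calc Real.log n ≤ gaussianLevel n ^ 2 / 2 + gaussianLevel n - c := this
      _ = _ := by field_simp

/-- A shift by `d = y / b_n` has `b_n d = y` while `d` and `d²` vanish, so both shift bounds
converge to `exp (-y)`. -/
theorem tendsto_mul_gaussianTail (y : ℝ) :
    Tendsto (fun n : ℕ => n * gaussianTail (gaussianLevel n + y / gaussianLevel n)) atTop
      (𝓝 (Real.exp (-y))) := by
  set b := gaussianLevel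
  have hinv : Tendsto (fun n => (b n)⁻¹) atTop (𝓝 0) :=
    tendsto_inv_atTop_zero.comp tendsto_gaussianLevel
  have hd : ∀ z : ℝ, Tendsto (fun n => z / b n) atTop (𝓝 0) := fun z => by
    simpa [div_eq_mul_inv] using hinv.const_mul z
  rcases le_total 0 y with hy | hy
  · have hlow : Tendsto (fun n => (1 - Real.exp (-b n - 1 / 2)) *
        Real.exp (-y - y / b n - (y / b n) ^ 2 / 2)) atTop
        (𝓝 ((1 - 0) * Real.exp (-y - 0 - 0))) := by
      refine .mul (.const_sub _ (Real.tendsto_exp_atBot.comp ?_))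
        ((Real.continuous_exp.tendsto _).comp (((hd y).const_sub (-y)).sub ?_))
      · exact tendsto_atBot_add_const_right _ (-(1 / 2))
          (tendsto_neg_atTop_atBot.comp tendsto_gaussianLevel)
      · simpa using ((hd y).pow 2).div_const 2
    have hupp : Tendsto (fun n => Real.exp (-y - (y / b n) ^ 2 / 2)) atTop
        (𝓝 (Real.exp (-y - 0))) := by
      refine (Real.continuous_exp.tendsto _).comp (.const_sub (-y) ?_)
      simpa using ((hd y).pow 2).div_const 2
    rw [sub_zero, sub_zero, sub_zero, one_mul] at hlow
    rw [sub_zero] at hupp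
    refine tendsto_of_tendsto_of_tendsto_of_le_of_le' hlow hupp ?_ ?_ <;>
      filter_upwards [tendsto_gaussianLevel.eventually_gt_atTop 0, eventually_ge_atTop 2]
        with n hb hn
    · have h := le_gaussianTail_add (b n) (div_nonneg hy hb.le)
      rw [gaussianTail_gaussianLevel hn] at h
      have hn0 : (0 : ℝ) < n := by positivity
      rw [one_div, mul_assoc, inv_mul_le_iff₀ hn0] at h
      convert h using 4
      have : b n * (y / b n) = y := mul_div_cancel₀ y hb.ne'
      linarith
    · have h := gaussianTail_add_le (b n) (div_nonneg hy hb.le)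
      rw [gaussianTail_gaussianLevel hn] at h
      have hn0 : (0 : ℝ) < n := by positivity
      rw [one_div, le_inv_mul_iff₀ hn0] at h
      rwa [mul_div_cancel₀ y hb.ne'] at h
  -- The shift bounds need `d ≥ 0`; for negative `y` they are applied from `b_n + y / b_n` up to
  -- `b_n` and then solved for the tail at the lower point.
  · have hlow : Tendsto (fun n => Real.exp (-y - (y / b n) ^ 2 / 2)) atTop
        (𝓝 (Real.exp (-y - 0))) := by
      refine (Real.continuous_exp.tendsto _).comp (.const_sub (-y) ?_)
      simpa using ((hd y).pow 2).div_const 2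
    have hupp : Tendsto (fun n => Real.exp (-y - y / b n - (y / b n) ^ 2 / 2) /
        (1 - Real.exp (-(b n + y / b n) - 1 / 2))) atTop (𝓝 (Real.exp (-y - 0 - 0) / (1 - 0))) := by
      refine .div ((Real.continuous_exp.tendsto _).comp (((hd y).const_sub (-y)).sub ?_))
        (.const_sub _ (Real.tendsto_exp_atBot.comp ?_)) (by norm_num)
      · simpa using ((hd y).pow 2).div_const 2
      · exact tendsto_atBot_add_const_right _ (-(1 / 2))
          (tendsto_neg_atTop_atBot.comp (tendsto_gaussianLevel.atTop_add (hd y)))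
    rw [sub_zero, sub_zero, sub_zero, div_one] at hupp
    rw [sub_zero] at hlow
    refine tendsto_of_tendsto_of_tendsto_of_le_of_le' hlow hupp ?_ ?_
    · filter_upwards [tendsto_gaussianLevel.eventually_gt_atTop 0, eventually_ge_atTop 2]
        with n hb hn
      have h := gaussianTail_add_le (b n + y / b n) (div_nonneg (neg_nonneg.2 hy) hb.le)
      rw [neg_div, add_neg_cancel_right, gaussianTail_gaussianLevel hn, one_div] at h
      have hn0 : (0 : ℝ) < n := by positivity
      rw [inv_le_iff_one_le_mul₀' hn0, ← mul_assoc] at h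
      have h2 : Real.exp (-y - (y / b n) ^ 2 / 2) *
          Real.exp (-((b n + y / b n) * -(y / b n)) - (-(y / b n)) ^ 2 / 2) = 1 := by
        rw [← Real.exp_add, Real.exp_eq_one_iff]
        have : b n * (y / b n) = y := mul_div_cancel₀ y hb.ne'
        linear_combination this
      nlinarith [Real.exp_pos (-((b n + y / b n) * -(y / b n)) - (-(y / b n)) ^ 2 / 2)]
    · filter_upwards [tendsto_gaussianLevel.eventually_gt_atTop 0, eventually_ge_atTop 2,
        (tendsto_gaussianLevel.atTop_add (hd y)).eventually_gt_atTop 0] with n hb hn hx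
      have h := le_gaussianTail_add (b n + y / b n) (div_nonneg (neg_nonneg.2 hy) hb.le)
      rw [neg_div, add_neg_cancel_right, gaussianTail_gaussianLevel hn] at h
      have hn0 : (0 : ℝ) < n := by positivity
      have he : 0 < 1 - Real.exp (-(b n + y / b n) - 1 / 2) := by
        have : Real.exp (-(b n + y / b n) - 1 / 2) < 1 :=
          (Real.exp_lt_exp.2 (by linarith)).trans_eq Real.exp_zero
        linarith
      rw [le_div_iff₀ he]
      rw [le_div_iff₀' hn0] at h
      have h2 : Real.exp (-y - y / b n - (y / b n) ^ 2 / 2) *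
          Real.exp (-((b n + y / b n + 1) * -(y / b n)) - (-(y / b n)) ^ 2 / 2) = 1 := by
        rw [← Real.exp_add, Real.exp_eq_one_iff]
        have : b n * (y / b n) = y := mul_div_cancel₀ y hb.ne'
        linear_combination this
      replace h := h.trans_eq h2.symm
      rw [← mul_assoc, ← mul_assoc] at h
      exact le_of_mul_le_mul_right h (Real.exp_pos _)

theorem tendsto_one_sub_gaussianTail_pow (y : ℝ) :
    Tendsto (fun n : ℕ => (1 - gaussianTail (gaussianLevel n + y / gaussianLevel n)) ^ n) atTop
      (𝓝 (Real.exp (-Real.exp (-y)))) := by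
  simp_rw [sub_eq_add_neg 1 (gaussianTail _)]
  refine Real.tendsto_one_add_pow_exp_of_tendsto ?_
  simpa using (tendsto_mul_gaussianTail y).neg

/-- The union bound, in the form of Bernoulli's inequality. Unlike the limit, it is uniform in `n`,
as domination requires. -/
theorem one_sub_pow_le_exp {n : ℕ} (hn : 2 ≤ n) (hb : 0 < gaussianLevel n) {y : ℝ} (hy : 0 ≤ y) :
    1 - (1 - gaussianTail (gaussianLevel n + y / gaussianLevel n)) ^ n ≤ Real.exp (-y) := by
  have h := gaussianTail_add_le (gaussianLevel n) (div_nonneg hy hb.le)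
  have hn0 : (0 : ℝ) < n := by positivity
  rw [gaussianTail_gaussianLevel hn, one_div, le_inv_mul_iff₀ hn0,
    mul_div_cancel₀ y hb.ne'] at h
  have hber := one_add_mul_le_pow (a := -gaussianTail (gaussianLevel n + y / gaussianLevel n))
    (by linarith [gaussianTail_le_one (gaussianLevel n + y / gaussianLevel n)]) n
  rw [← sub_eq_add_neg] at hber
  have : Real.exp (-y - (y / gaussianLevel n) ^ 2 / 2) ≤ Real.exp (-y) :=
    Real.exp_le_exp.2 (by linarith [sq_nonneg (y / gaussianLevel n)])
  linarith

/-- Lower deviations of the maximum, uniformly in `n` and for all `y ≥ 0`. While the threshold is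
nonnegative, the expected number of exceedances is at least `exp (y / 2)`; below zero, Gaussian
decay takes over. The rate `1 / 2` is not sharp, but it suffices for finite moments. -/
theorem pow_le_exp_neg_half {n : ℕ} (hn : 2 ≤ n) (hb : 0 < gaussianLevel n) {y : ℝ} (hy : 0 ≤ y) :
    (1 - gaussianTail (gaussianLevel n - y / gaussianLevel n)) ^ n ≤ Real.exp (-(y / 2)) := by
  set b := gaussianLevel n
  have hn0 : (0 : ℝ) < n := by positivity
  have hyb : b * (y / b) = y := mul_div_cancel₀ y hb.ne'
  rcases le_total (y / b) b with h | h
  · have h1 := gaussianTail_add_le (b - y / b) (div_nonneg hy hb.le)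
    rw [sub_add_cancel, gaussianTail_gaussianLevel hn, one_div, inv_le_iff_one_le_mul₀' hn0,
      ← mul_assoc] at h1
    have h2 : y / 2 ≤ n * gaussianTail (b - y / b) := by
      have he : Real.exp (-((b - y / b) * (y / b)) - (y / b) ^ 2 / 2) ≤ Real.exp (-(y / 2)) := by
        refine Real.exp_le_exp.2 ?_
        -- With `d = y / b ≤ b`, the exponent is `y - d² / 2` up to sign, and `d² ≤ b d = y`.
        nlinarith [div_nonneg hy hb.le]
      have h3 : 1 ≤ n * gaussianTail (b - y / b) * Real.exp (-(y / 2)) :=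
        h1.trans (mul_le_mul_of_nonneg_left he (mul_nonneg hn0.le (gaussianTail_nonneg _)))
      rw [Real.exp_neg, ← div_eq_mul_inv, one_le_div (Real.exp_pos _)] at h3
      linarith [Real.add_one_le_exp (y / 2)]
    calc (1 - gaussianTail (b - y / b)) ^ n ≤ Real.exp (-gaussianTail (b - y / b)) ^ n := by
          have := gaussianTail_le_one (b - y / b)
          have := Real.one_sub_le_exp_neg (gaussianTail (b - y / b))
          gcongr
      _ = Real.exp (-(n * gaussianTail (b - y / b))) := by rw [← Real.exp_nat_mul]; ring_nf
      _ ≤ _ := Real.exp_le_exp.2 (by linarith)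
  · set s := y / b - b
    have hs : 0 ≤ s := sub_nonneg.2 h
    have hbs : b - y / b = -s := by ring
    rw [hbs, gaussianTail_neg, sub_sub_cancel]
    have h1 : gaussianTail s ≤ Real.exp (-((1 + s) / 2)) := by
      refine (gaussianTail_le_half_exp hs).trans ?_
      rw [show (1 / 2 : ℝ) = Real.exp (-Real.log 2) by
        rw [Real.exp_neg, Real.exp_log two_pos, one_div], ← Real.exp_add]
      refine Real.exp_le_exp.2 ?_
      -- Since `log 2 > 5 / 8`, the inequality reduces to `(s - 1 / 2)² ≥ 0`.
      nlinarith [Real.log_two_gt_d9, sq_nonneg (s - 1 / 2)]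
    have h2 : b ^ 2 + 2 ≤ n := by
      have h3 := le_log_of_gaussianLevel hn
      have h4 := Real.add_one_le_exp (b ^ 2 / 2)
      have h5 : Real.exp (b ^ 2 / 2) * 2 ≤ n := by
        rw [← Real.exp_log hn0, ← Real.exp_log (two_pos (α := ℝ)), ← Real.exp_add,
          Real.exp_log two_pos]
        exact Real.exp_le_exp.2 h3
      linarith
    calc gaussianTail s ^ n ≤ Real.exp (-((1 + s) / 2)) ^ n := by
          have := gaussianTail_nonneg s
          gcongr
      _ = Real.exp (-(n * (1 + s) / 2)) := by rw [← Real.exp_nat_mul]; ring_nf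
      _ ≤ _ := by
        refine Real.exp_le_exp.2 ?_
        have hy' : y = b ^ 2 + b * s := by simp only [s]; rw [mul_sub, hyb]; ring
        have : b ≤ n := by nlinarith [sq_nonneg (b - 1)]
        nlinarith

/-- The logarithm of the shift bound between the two levels. Sample sizes with ratio tending to one
thus have levels that agree to within `o(1 / b)`, finer than the Gumbel scale. -/
theorem gaussianLevel_mul_sub_le {m n : ℕ} (hm : 2 ≤ m) (hn : 2 ≤ n)
    (h : gaussianLevel m ≤ gaussianLevel n) :
    gaussianLevel m * (gaussianLevel n - gaussianLevel m) ≤ Real.log (n / m) := by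
  have h1 := gaussianTail_add_le (gaussianLevel m) (sub_nonneg.2 h)
  have hn0 : (0 : ℝ) < n := by positivity
  have hm0 : (0 : ℝ) < m := by positivity
  rw [add_sub_cancel, gaussianTail_gaussianLevel hn, gaussianTail_gaussianLevel hm] at h1
  have h2 := Real.log_le_log (by positivity) h1
  rw [Real.log_mul (by positivity) (Real.exp_pos _).ne', Real.log_exp, one_div, one_div,
    Real.log_inv, Real.log_inv] at h2
  rw [Real.log_div hn0.ne' hm0.ne']
  nlinarith [sq_nonneg (gaussianLevel n - gaussianLevel m)]

theorem abs_gaussianLevel_sub_le {m n : ℕ} (hm : 2 ≤ m) (hn : 2 ≤ n) (hbm : 1 ≤ gaussianLevel m)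
    (hbn : 1 ≤ gaussianLevel n) :
    |gaussianLevel m - gaussianLevel n| ≤ |Real.log (m / n)| ∧
      |gaussianLevel m * (gaussianLevel m - gaussianLevel n)| ≤
        |Real.log (m / n)| + |Real.log (m / n)| ^ 2 := by
  set a := gaussianLevel m
  set b := gaussianLevel n
  have hsymm : Real.log ((n : ℝ) / m) = -Real.log (m / n) := by rw [← Real.log_inv, inv_div]
  rw [abs_mul, abs_of_nonneg (by linarith : 0 ≤ a)]
  rcases le_total a b with h | h
  · have h1 := (gaussianLevel_mul_sub_le hm hn h).trans (le_abs_self _)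
    rw [hsymm, abs_neg] at h1
    change a * (b - a) ≤ _ at h1
    rw [abs_of_nonpos (sub_nonpos.2 h)]
    constructor <;> nlinarith
  -- The gap is controlled here with the smaller level `b` as factor; `a (a - b) = b (a - b) + (a -
  -- b)²` accounts for the quadratic term.
  · have h1 := (gaussianLevel_mul_sub_le hn hm h).trans (le_abs_self _)
    change b * (a - b) ≤ _ at h1
    rw [abs_of_nonneg (sub_nonneg.2 h)]
    have h2 : a - b ≤ |Real.log (m / n)| := by nlinarith
    refine ⟨h2, ?_⟩
    nlinarith

theorem tendsto_gaussianLevel_sub {m n : ℕ → ℕ} (hm : Tendsto m atTop atTop)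
    (hn : Tendsto n atTop atTop) (h : Tendsto (fun k => (m k : ℝ) / n k) atTop (𝓝 1)) :
    Tendsto (fun k => gaussianLevel (m k) / gaussianLevel (n k)) atTop (𝓝 1) ∧
    Tendsto (fun k => gaussianLevel (m k) * (gaussianLevel (m k) - gaussianLevel (n k))) atTop
      (𝓝 0) := by
  have hL : Tendsto (fun k => |Real.log ((m k : ℝ) / n k)|) atTop (𝓝 0) := by
    simpa using (h.log one_ne_zero).abs
  have hev : ∀ᶠ k in atTop, |gaussianLevel (m k) - gaussianLevel (n k)| ≤ |Real.log (m k / n k)| ∧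
      |gaussianLevel (m k) * (gaussianLevel (m k) - gaussianLevel (n k))| ≤
        |Real.log (m k / n k)| + |Real.log (m k / n k)| ^ 2 := by
    filter_upwards [hm.eventually_ge_atTop 2, hn.eventually_ge_atTop 2,
      (tendsto_gaussianLevel.comp hm).eventually_ge_atTop 1,
      (tendsto_gaussianLevel.comp hn).eventually_ge_atTop 1] with k h1 h2 h3 h4
    exact abs_gaussianLevel_sub_le h1 h2 h3 h4
  constructor
  · rw [tendsto_iff_norm_sub_tendsto_zero]
    refine squeeze_zero' (.of_forall fun _ => norm_nonneg _) ?_ hL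
    filter_upwards [hev, (tendsto_gaussianLevel.comp hn).eventually_ge_atTop 1] with k hk h1
    have h1' : 1 ≤ gaussianLevel (n k) := h1
    have h0 : 0 < gaussianLevel (n k) := by linarith
    rw [div_sub_one h0.ne', Real.norm_eq_abs, abs_div, abs_of_pos h0]
    exact (div_le_self (abs_nonneg _) h1').trans hk.1
  · refine squeeze_zero_norm' (hev.mono fun k hk => hk.2) ?_
    simpa using hL.add (hL.pow 2)

/-! ### Quantile functions on the unit interval -/

/-- The uniform distribution on the unit interval. -/
noncomputable def uniform01 : Measure ℝ := volume.restrict (Set.Ioo 0 1)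

instance : IsProbabilityMeasure uniform01 := ⟨by simp [uniform01]⟩

theorem ae_uniform01 {p : ℝ → Prop} (h : ∀ u ∈ Set.Ioo (0 : ℝ) 1, p u) : ∀ᵐ u ∂uniform01, p u :=
  (ae_restrict_iff' measurableSet_Ioo).2 (.of_forall h)

theorem measurePreserving_one_sub_uniform01 :
    MeasurePreserving (fun u : ℝ => 1 - u) uniform01 uniform01 := by
  have h := (Measure.measurePreserving_sub_left (volume : Measure ℝ) 1).restrict_preimage
    (measurableSet_Ioo (a := (0 : ℝ)) (b := 1))
  have : (fun u : ℝ => 1 - u) ⁻¹' Set.Ioo 0 1 = Set.Ioo 0 1 := by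
    simp
  rwa [this] at h

theorem uniform01_Iic {c : ℝ} (h0 : 0 ≤ c) (h1 : c ≤ 1) :
    uniform01 (Set.Iic c) = ENNReal.ofReal c := by
  rw [uniform01, Measure.restrict_apply measurableSet_Iic]
  rcases h1.lt_or_eq with h | rfl
  · have : Set.Iic c ∩ Set.Ioo 0 1 = Set.Ioc 0 c := by
      ext u; simp only [Set.mem_inter_iff, Set.mem_Iic, Set.mem_Ioo, Set.mem_Ioc]
      constructor
      · rintro ⟨h2, h3, -⟩; exact ⟨h3, h2⟩
      · rintro ⟨h2, h3⟩; exact ⟨h3, h2, h3.trans_lt h⟩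
    rw [this, Real.volume_Ioc, sub_zero]
  · rw [Set.inter_eq_right.2 fun u hu => hu.2.le, Real.volume_Ioo, sub_zero]

theorem uniform01_Ioi {c : ℝ} (h0 : 0 ≤ c) (h1 : c ≤ 1) :
    uniform01 (Set.Ioi c) = ENNReal.ofReal (1 - c) := by
  rw [← Set.compl_Iic, prob_compl_eq_one_sub measurableSet_Iic, uniform01_Iic h0 h1,
    ENNReal.ofReal_sub _ h0, ENNReal.ofReal_one]

/-- The quantile function of a real measure. -/
noncomputable def quantile (ν : Measure ℝ) (u : ℝ) : ℝ := sInf {x | u ≤ cdf ν x}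

/-- Right continuity of the distribution function makes the infimum attained. This equivalence turns
every bound on a distribution function into one on quantiles. -/
theorem quantile_le_iff (ν : Measure ℝ) {u : ℝ} (hu : u ∈ Set.Ioo (0 : ℝ) 1) (x : ℝ) :
    quantile ν u ≤ x ↔ u ≤ cdf ν x := by
  have hne : {x | u ≤ cdf ν x}.Nonempty :=
    ((tendsto_cdf_atTop ν).eventually (lt_mem_nhds hu.2)).exists.imp fun x hx => le_of_lt hx
  have hbdd : BddBelow {x | u ≤ cdf ν x} := by
    obtain ⟨y, hy⟩ := ((tendsto_cdf_atBot ν).eventually (gt_mem_nhds hu.1)).exists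
    refine ⟨y, fun x hx => ?_⟩
    by_contra! hlt
    exact absurd ((show u ≤ cdf ν x from hx).trans (monotone_cdf ν hlt.le)) hy.not_ge
  constructor
  · intro h
    refine le_trans ?_ (monotone_cdf ν h)
    have hc := ((cdf ν).right_continuous (quantile ν u)).mono Set.Ioi_subset_Ici_self
    refine ge_of_tendsto hc (eventually_mem_nhdsWithin.mono fun y hy => ?_)
    obtain ⟨s, hs, hsy⟩ := exists_lt_of_csInf_lt hne (show sInf _ < y from hy)
    exact (show u ≤ cdf ν s from hs).trans (monotone_cdf ν hsy.le)
  · intro h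
    exact csInf_le hbdd h

theorem monotoneOn_quantile (ν : Measure ℝ) : MonotoneOn (quantile ν) (Set.Ioo 0 1) :=
  fun _ hu _ hv huv => (quantile_le_iff ν hu _).2 (huv.trans ((quantile_le_iff ν hv _).1 le_rfl))

theorem aemeasurable_quantile (ν : Measure ℝ) : AEMeasurable (quantile ν) uniform01 :=
  aemeasurable_restrict_of_monotoneOn measurableSet_Ioo (monotoneOn_quantile ν)

theorem map_quantile_uniform01 (ν : Measure ℝ) [IsProbabilityMeasure ν] :
    uniform01.map (quantile ν) = ν := by
  have := Measure.isProbabilityMeasure_map (aemeasurable_quantile ν)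
  refine Measure.ext_of_Iic _ _ fun x => ?_
  rw [Measure.map_apply_of_aemeasurable (aemeasurable_quantile ν) measurableSet_Iic, ← ofReal_cdf,
    ← uniform01_Iic (cdf_nonneg ν x) (cdf_le_one ν x)]
  refine measure_congr ?_
  filter_upwards [ae_uniform01 (p := fun u => u ∈ Set.Ioo (0 : ℝ) 1) fun u hu => hu] with u hu
  exact propext (quantile_le_iff ν hu x)

theorem memLp_log_uniform01 : MemLp Real.log 4 uniform01 := by
  -- The exponent `1 / 8` makes the fourth power `u ^ (-1 / 2)`, still integrable at `0`.
  have h1 : MemLp (fun u : ℝ => 8 * u ^ (-(1 / 8) : ℝ)) 4 uniform01 := by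
    refine MemLp.const_mul ?_ 8
    have hm : AEStronglyMeasurable (fun u : ℝ => u ^ (-(1 / 8) : ℝ)) uniform01 :=
      (measurable_id.pow_const _).aestronglyMeasurable
    rw [← integrable_norm_rpow_iff hm (by norm_num) (by norm_num)]
    have h2 : IntegrableOn (fun u : ℝ => u ^ (-(1 / 2) : ℝ)) (Set.Ioo 0 1) :=
      (intervalIntegral.integrableOn_Ioo_rpow_iff one_pos).2 (by norm_num)
    refine h2.congr (ae_uniform01 fun u hu => ?_)
    simp only
    rw [Real.norm_of_nonneg (Real.rpow_nonneg hu.1.le _), ← Real.rpow_mul hu.1.le]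
    norm_num
  refine h1.mono Real.measurable_log.aestronglyMeasurable (ae_uniform01 fun u hu => ?_)
  have h := Real.abs_log_mul_self_rpow_lt u (1 / 8) hu.1 hu.2.le (by norm_num)
  have hp : 0 < u ^ (1 / 8 : ℝ) := Real.rpow_pos_of_pos hu.1 _
  rw [abs_mul, abs_of_pos hp] at h
  rw [Real.norm_eq_abs, Real.norm_eq_abs, abs_mul, Real.rpow_neg hu.1.le, abs_inv, abs_of_pos hp,
    ← div_eq_mul_inv, le_div_iff₀ hp]
  refine h.le.trans ?_
  norm_num

/-- An integrable bound for the rescaled quantiles of Gaussian maxima. -/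
noncomputable def quantileBound (u : ℝ) : ℝ := 1 - 2 * Real.log u - Real.log (1 - u)

theorem memLp_quantileBound : MemLp quantileBound 4 uniform01 :=
  ((memLp_const 1).sub (memLp_log_uniform01.const_mul 2)).sub
    (memLp_log_uniform01.comp_measurePreserving measurePreserving_one_sub_uniform01)

/-! ### Rescaled Gaussian maxima: convergence and domination -/

/-- The law of the maximum of `n` independent standard Gaussian variables. -/
noncomputable def gaussianMax (n : ℕ) : Measure ℝ :=
  (Measure.pi fun _ : Fin n => gaussianReal 0 1).map fun x => ⨆ i, x i

theorem measurable_iSup_apply (n : ℕ) : Measurable fun x : Fin n → ℝ => ⨆ i, x i :=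
  Measurable.iSup fun i => measurable_pi_apply i

instance (n : ℕ) : IsProbabilityMeasure (gaussianMax n) :=
  Measure.isProbabilityMeasure_map (measurable_iSup_apply n).aemeasurable

theorem cdf_gaussianMax {n : ℕ} (hn : 0 < n) (x : ℝ) :
    cdf (gaussianMax n) x = (1 - gaussianTail x) ^ n := by
  have : Nonempty (Fin n) := ⟨⟨0, hn⟩⟩
  have hpre : (fun x : Fin n → ℝ => ⨆ i, x i) ⁻¹' Set.Iic x =
      Set.univ.pi fun _ => Set.Iic x := by
    ext z
    simp [ciSup_le_iff (Set.finite_range z).bddAbove, Pi.le_def]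
  rw [cdf_eq_real, gaussianMax, map_measureReal_apply (measurable_iSup_apply n) measurableSet_Iic,
    hpre, measureReal_def, Measure.pi_pi]
  simp [← cdf_gaussianReal_eq, cdf_eq_real, measureReal_def]

/-- The quantile function of the rescaled maximum of `n` standard Gaussian variables. -/
noncomputable def scaledQuantile (n : ℕ) (u : ℝ) : ℝ :=
  gaussianLevel n * (quantile (gaussianMax n) u - gaussianLevel n)

theorem scaledQuantile_le_iff {n : ℕ} (hn : 0 < n) (hb : 0 < gaussianLevel n) {u : ℝ}
    (hu : u ∈ Set.Ioo (0 : ℝ) 1) (y : ℝ) :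
    scaledQuantile n u ≤ y ↔
      u ≤ (1 - gaussianTail (gaussianLevel n + y / gaussianLevel n)) ^ n := by
  rw [← cdf_gaussianMax hn, ← quantile_le_iff _ hu, scaledQuantile, ← le_div_iff₀' hb,
    sub_le_iff_le_add']

/-- The Gumbel distribution function is strictly increasing, so convergence of distribution
functions passes to their inverses at every `u`. -/
theorem tendsto_scaledQuantile {u : ℝ} (hu : u ∈ Set.Ioo (0 : ℝ) 1) :
    Tendsto (fun n => scaledQuantile n u) atTop (𝓝 (-Real.log (-Real.log u))) := by
  have hlog : 0 < -Real.log u := neg_pos.2 (Real.log_neg hu.1 hu.2)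
  have hev : ∀ᶠ n : ℕ in atTop, 0 < n ∧ 0 < gaussianLevel n :=
    (eventually_gt_atTop 0).and (tendsto_gaussianLevel.eventually_gt_atTop 0)
  refine tendsto_order.2 ⟨fun a ha => ?_, fun a ha => ?_⟩
  · have h : Real.exp (-Real.exp (-a)) < u := by
      rw [← Real.lt_log_iff_exp_lt hu.1, neg_lt, ← Real.log_lt_iff_lt_exp hlog]
      linarith
    filter_upwards [hev, (tendsto_one_sub_gaussianTail_pow a).eventually (gt_mem_nhds h)]
      with n hn hlt
    rw [← not_le, scaledQuantile_le_iff hn.1 hn.2 hu]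
    exact hlt.not_ge
  · obtain ⟨a', ha', haa'⟩ := exists_between ha
    have h : u < Real.exp (-Real.exp (-a')) := by
      rw [← Real.log_lt_iff_lt_exp hu.1, lt_neg, ← Real.lt_log_iff_exp_lt hlog]
      linarith
    filter_upwards [hev, (tendsto_one_sub_gaussianTail_pow a').eventually (lt_mem_nhds h)]
      with n hn hlt
    exact ((scaledQuantile_le_iff hn.1 hn.2 hu _).2 hlt.le).trans_lt haa'

theorem abs_scaledQuantile_le {n : ℕ} (hn : 2 ≤ n) (hb : 0 < gaussianLevel n) {u : ℝ}
    (hu : u ∈ Set.Ioo (0 : ℝ) 1) : |scaledQuantile n u| ≤ quantileBound u := by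
  have h1 := Real.log_neg hu.1 hu.2
  have h1u : 0 < 1 - u := sub_pos.2 hu.2
  have h2 := Real.log_neg h1u (by linarith [hu.1])
  have hn0 : 0 < n := by omega
  rw [abs_le, quantileBound]
  constructor
  -- The choice `y = -2 log u` would give exactly `u`; the added `1` makes the comparison strict.
  · have h3 := pow_le_exp_neg_half hn hb (y := 1 - 2 * Real.log u) (by linarith)
    have h4 : Real.exp (-((1 - 2 * Real.log u) / 2)) < u := by
      rw [← Real.lt_log_iff_exp_lt hu.1]; linarith
    have h5 : ¬ scaledQuantile n u ≤ -(1 - 2 * Real.log u) := by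
      rw [scaledQuantile_le_iff hn0 hb hu, neg_div, ← sub_eq_add_neg]
      exact (h3.trans_lt h4).not_ge
    linarith
  · have h3 := one_sub_pow_le_exp hn hb (y := -Real.log (1 - u)) (by linarith)
    rw [neg_neg, Real.exp_log h1u] at h3
    have h5 : scaledQuantile n u ≤ -Real.log (1 - u) := by
      rw [scaledQuantile_le_iff hn0 hb hu]; linarith
    linarith

/-! ### The difference of two Gumbel variables -/

theorem hasSum_alternating_inv_sq :
    HasSum (fun n : ℕ => (-1 : ℝ) ^ n * (1 / ((n : ℝ) + 1) ^ 2)) (Real.pi ^ 2 / 12) := by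
  have hz := hasSum_zeta_two
  have he : HasSum (fun n : ℕ => 1 / ((2 * n : ℕ) : ℝ) ^ 2) (Real.pi ^ 2 / 24) := by
    have h1 : (fun n : ℕ => 1 / ((2 * n : ℕ) : ℝ) ^ 2) = fun n : ℕ => 1 / 4 * (1 / (n : ℝ) ^ 2) := by
      ext n; rw [one_div_mul_one_div]; push_cast; ring
    rw [h1, show Real.pi ^ 2 / 24 = 1 / 4 * (Real.pi ^ 2 / 6) by ring]
    exact hz.mul_left (1 / 4)
  have ho : HasSum (fun n : ℕ => 1 / ((2 * n + 1 : ℕ) : ℝ) ^ 2) (Real.pi ^ 2 / 8) := by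
    have hs : Summable (fun n : ℕ => 1 / ((2 * n + 1 : ℕ) : ℝ) ^ 2) :=
      hz.summable.comp_injective (i := fun n : ℕ => 2 * n + 1) fun a b h => by simpa using h
    have h1 := (he.even_add_odd (f := fun n : ℕ => 1 / (n : ℝ) ^ 2) hs.hasSum).unique hz
    rw [show Real.pi ^ 2 / 8 = Real.pi ^ 2 / 6 - Real.pi ^ 2 / 24 by ring, ← h1, add_sub_cancel_left]
    exact hs.hasSum
  have h := HasSum.even_add_odd (f := fun n : ℕ => (-1 : ℝ) ^ (n + 1) * (1 / (n : ℝ) ^ 2))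
    (m := -(Real.pi ^ 2 / 24)) (m' := Real.pi ^ 2 / 8)
    (by simpa [pow_succ, pow_mul] using he.neg) (by simpa [pow_add, pow_mul] using ho)
  -- The term of index `0` vanishes because `1 / 0 = 0`, so the shift leaves the sum unchanged.
  rw [← hasSum_nat_add_iff' 1] at h
  have h1 : (fun n : ℕ => (-1 : ℝ) ^ n * (1 / ((n : ℝ) + 1) ^ 2)) =
      fun n : ℕ => (-1 : ℝ) ^ (n + 1 + 1) * (1 / ((n + 1 : ℕ) : ℝ) ^ 2) := by
    ext n; simp [pow_succ]
  rw [h1, show Real.pi ^ 2 / 12 = -(Real.pi ^ 2 / 24) + Real.pi ^ 2 / 8 -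
    ∑ i ∈ Finset.range 1, (-1) ^ (i + 1) * (1 / (i : ℝ) ^ 2) by simp; ring]
  exact h

theorem integral_mul_exp_neg_mul (n : ℕ) :
    ∫ t in Set.Ioi (0 : ℝ), t * Real.exp (-((n + 1) * t)) = 1 / ((n : ℝ) + 1) ^ 2 := by
  have h := Real.integral_rpow_mul_exp_neg_mul_Ioi (a := 2) (r := n + 1) two_pos (by positivity)
  norm_num at h
  rw [one_div, ← h]

theorem integrableOn_mul_exp_neg_mul (n : ℕ) :
    IntegrableOn (fun t : ℝ => t * Real.exp (-((n + 1) * t))) (Set.Ioi 0) := by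
  -- A non-integrable function has integral `0` by convention, so a nonzero value proves
  -- integrability.
  refine Integrable.of_integral_ne_zero ?_
  rw [integral_mul_exp_neg_mul]
  positivity

/-- Expanding `1 / (1 + exp t)` as an alternating geometric series in `exp (-t)` gives the
alternating series of inverse squares; its absolute convergence justifies the interchange. -/
theorem integral_div_one_add_exp :
    ∫ t in Set.Ioi (0 : ℝ), t * (1 / (1 + Real.exp t)) = Real.pi ^ 2 / 12 := by
  have hnorm : ∀ n : ℕ, ∫ t in Set.Ioi (0 : ℝ), ‖(-1 : ℝ) ^ n * (t * Real.exp (-((n + 1) * t)))‖ =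
      1 / ((n : ℝ) + 1) ^ 2 := fun n => by
    rw [← integral_mul_exp_neg_mul]
    refine setIntegral_congr_fun measurableSet_Ioi fun t ht => ?_
    have ht' : (0 : ℝ) < t := ht
    simp [abs_of_pos ht']
  have hsum : Summable fun n : ℕ => 1 / ((n : ℝ) + 1) ^ 2 := by
    simpa using (summable_nat_add_iff 1).2 hasSum_zeta_two.summable
  have h := hasSum_integral_of_summable_integral_norm
    (fun n : ℕ => (integrableOn_mul_exp_neg_mul n).const_mul ((-1) ^ n))
    (by simpa only [hnorm] using hsum)
  simp only [integral_const_mul, integral_mul_exp_neg_mul] at h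
  rw [← h.unique hasSum_alternating_inv_sq]
  refine setIntegral_congr_fun measurableSet_Ioi fun t ht => ?_
  have ht' : (0 : ℝ) < t := ht
  have hlt : Real.exp (-t) < 1 := (Real.exp_lt_exp.2 (by linarith)).trans_eq Real.exp_zero
  have hg := (hasSum_geometric_of_norm_lt_one (ξ := -Real.exp (-t))
    (by rwa [norm_neg, Real.norm_of_nonneg (Real.exp_pos _).le])).mul_left (t * Real.exp (-t))
  have h2 : (fun n : ℕ => t * Real.exp (-t) * (-Real.exp (-t)) ^ n) =
      fun n : ℕ => (-1 : ℝ) ^ n * (t * Real.exp (-((n + 1) * t))) := by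
    ext n
    rw [neg_pow, ← Real.exp_nat_mul, show -((n + 1) * t) = -t + n * -t by ring, Real.exp_add]
    ring
  rw [h2] at hg
  refine Eq.trans ?_ hg.tsum_eq.symm
  rw [sub_neg_eq_add, Real.exp_neg]
  have := Real.exp_pos t
  field_simp
  ring

theorem integrableOn_div_one_add_exp :
    IntegrableOn (fun t : ℝ => t * (1 / (1 + Real.exp t))) (Set.Ioi 0) := by
  refine Integrable.of_integral_ne_zero ?_
  rw [integral_div_one_add_exp]
  positivity

/-- The quantile function of the standard Gumbel law. -/
noncomputable def gumbelQuantile (u : ℝ) : ℝ := -Real.log (-Real.log u)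

theorem measurable_gumbelQuantile : Measurable gumbelQuantile := by
  unfold gumbelQuantile; fun_prop

theorem lt_gumbelQuantile_sub_iff {u v t : ℝ} (hu : u ∈ Set.Ioo (0 : ℝ) 1)
    (hv : v ∈ Set.Ioo (0 : ℝ) 1) :
    t < gumbelQuantile u - gumbelQuantile v ↔ v ^ Real.exp (-t) < u := by
  have hu' : 0 < -Real.log u := neg_pos.2 (Real.log_neg hu.1 hu.2)
  have hv' : 0 < -Real.log v := neg_pos.2 (Real.log_neg hv.1 hv.2)
  rw [← Real.log_lt_log_iff (Real.rpow_pos_of_pos hv.1 _) hu.1, Real.log_rpow hv.1,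
    ← neg_lt_neg_iff (a := Real.log u), ← mul_neg,
    ← Real.log_lt_log_iff hu' (by positivity), Real.log_mul (Real.exp_pos _).ne' hv'.ne',
    Real.log_exp, gumbelQuantile, gumbelQuantile]
  constructor <;> intro h <;> linarith

/-- The logistic tail: given `v`, the event is `u > v ^ a` with `a = exp (-t)`, and `∫ (1 - v ^ a)
dv = a / (1 + a)`. -/
theorem measure_lt_gumbelQuantile_sub (t : ℝ) :
    (uniform01.prod uniform01) {p | t < gumbelQuantile p.1 - gumbelQuantile p.2} =
      ENNReal.ofReal (1 / (1 + Real.exp t)) := by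
  have hmeas : MeasurableSet {p : ℝ × ℝ | t < gumbelQuantile p.1 - gumbelQuantile p.2} :=
    measurableSet_lt measurable_const ((measurable_gumbelQuantile.comp measurable_fst).sub
      (measurable_gumbelQuantile.comp measurable_snd))
  have ha : 0 < Real.exp (-t) := Real.exp_pos _
  rw [Measure.prod_apply_symm hmeas]
  have h1 : ∀ᵐ v ∂uniform01, uniform01 ((fun u => (u, v)) ⁻¹'
      {p : ℝ × ℝ | t < gumbelQuantile p.1 - gumbelQuantile p.2}) =
      ENNReal.ofReal (1 - v ^ Real.exp (-t)) := ae_uniform01 fun v hv => by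
    rw [← uniform01_Ioi (Real.rpow_nonneg hv.1.le _) (Real.rpow_le_one hv.1.le hv.2.le ha.le)]
    refine measure_congr ?_
    filter_upwards [ae_uniform01 (p := fun u => u ∈ Set.Ioo (0 : ℝ) 1) fun u hu => hu] with u hu
    exact propext (lt_gumbelQuantile_sub_iff hu hv)
  rw [lintegral_congr_ae h1]
  have hi : IntegrableOn (fun v : ℝ => v ^ Real.exp (-t)) (Set.Ioo 0 1) :=
    (intervalIntegral.integrableOn_Ioo_rpow_iff one_pos).2 (by linarith)
  have hc : IntegrableOn (fun _ : ℝ => (1 : ℝ)) (Set.Ioo 0 1) := integrableOn_const (by simp)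
  have hci : IntegrableOn (fun v : ℝ => 1 - v ^ Real.exp (-t)) (Set.Ioo 0 1) := hc.sub hi
  rw [uniform01, ← ofReal_integral_eq_lintegral_ofReal hci
    (ae_uniform01 fun v hv => sub_nonneg.2 (Real.rpow_le_one hv.1.le hv.2.le ha.le)),
    integral_sub hc hi, ← integral_Ioc_eq_integral_Ioo, ← integral_Ioc_eq_integral_Ioo,
    ← intervalIntegral.integral_of_le zero_le_one, ← intervalIntegral.integral_of_le zero_le_one,
    integral_rpow (Or.inl (by linarith))]
  congr 1
  rw [Real.exp_neg] at *
  have := Real.exp_pos t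
  rw [Real.one_rpow, Real.zero_rpow (by positivity)]
  simp
  field_simp
  ring

/-- By the layer cake formula this is `2 ∫ t P(|D| > t) dt`. Exchanging the two variables shows that
both tails are equal, which gives `4 · π² / 12`. -/
theorem integral_gumbelQuantile_sub_sq :
    ∫ p, (gumbelQuantile p.1 - gumbelQuantile p.2) ^ 2 ∂(uniform01.prod uniform01) =
      Real.pi ^ 2 / 3 := by
  set μ := uniform01.prod uniform01
  have hm : Measurable fun p : ℝ × ℝ => gumbelQuantile p.1 - gumbelQuantile p.2 :=
    (measurable_gumbelQuantile.comp measurable_fst).sub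
      (measurable_gumbelQuantile.comp measurable_snd)
  have habs : ∀ t ∈ Set.Ioi (0 : ℝ), μ {p | t < |gumbelQuantile p.1 - gumbelQuantile p.2|} =
      ENNReal.ofReal (2 * (1 / (1 + Real.exp t))) := fun t ht => by
    have hset : {p : ℝ × ℝ | t < |gumbelQuantile p.1 - gumbelQuantile p.2|} =
        {p | t < gumbelQuantile p.1 - gumbelQuantile p.2} ∪
          Prod.swap ⁻¹' {p | t < gumbelQuantile p.1 - gumbelQuantile p.2} := by
      ext p
      simp only [Set.mem_ofPred_eq, Set.mem_union, Set.mem_preimage, Prod.fst_swap, Prod.snd_swap,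
        lt_abs, neg_sub]
    have hdisj : Disjoint {p : ℝ × ℝ | t < gumbelQuantile p.1 - gumbelQuantile p.2}
        (Prod.swap ⁻¹' {p | t < gumbelQuantile p.1 - gumbelQuantile p.2}) := by
      refine Set.disjoint_left.2 fun p h1 h2 => ?_
      simp only [Set.mem_ofPred_eq, Set.mem_preimage, Prod.fst_swap, Prod.snd_swap] at h1 h2
      linarith [show (0 : ℝ) < t from ht]
    have hms : MeasurableSet {p : ℝ × ℝ | t < gumbelQuantile p.1 - gumbelQuantile p.2} :=
      measurableSet_lt measurable_const hm
    rw [hset, measure_union hdisj (hms.preimage measurable_swap),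
      (Measure.measurePreserving_swap (μ := uniform01) (ν := uniform01)).measure_preimage
        hms.nullMeasurableSet,
      measure_lt_gumbelQuantile_sub, ← ENNReal.ofReal_add (by positivity) (by positivity), two_mul]
  have hlc := lintegral_rpow_eq_lintegral_meas_lt_mul μ
    (f := fun p => |gumbelQuantile p.1 - gumbelQuantile p.2|) (.of_forall fun _ => abs_nonneg _)
    (continuous_abs.measurable.comp hm).aemeasurable two_pos
  rw [integral_eq_lintegral_of_nonneg_ae (.of_forall fun _ => sq_nonneg _)
    (hm.pow_const 2).aestronglyMeasurable]
  have hl : ∫⁻ p, ENNReal.ofReal ((gumbelQuantile p.1 - gumbelQuantile p.2) ^ 2) ∂μ =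
      ENNReal.ofReal (Real.pi ^ 2 / 3) := by
    simp only [Real.rpow_two, sq_abs] at hlc
    rw [hlc, setLIntegral_congr_fun (g := fun t =>
      ENNReal.ofReal 2 * ENNReal.ofReal (t * (1 / (1 + Real.exp t)))) measurableSet_Ioi,
      lintegral_const_mul', ← ofReal_integral_eq_lintegral_ofReal integrableOn_div_one_add_exp,
      integral_div_one_add_exp, ← ENNReal.ofReal_mul zero_le_two, ← ENNReal.ofReal_mul zero_le_two]
    · congr 1; ring
    · refine (ae_restrict_iff' measurableSet_Ioi).2 (.of_forall fun t ht => ?_)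
      have : (0 : ℝ) < t := ht
      positivity
    · simp
    · intro t ht
      have : (0 : ℝ) < t := ht
      simp only
      rw [habs t ht, ← ENNReal.ofReal_mul (by positivity), ← ENNReal.ofReal_mul zero_le_two]
      congr 1
      norm_num
      ring
  rw [hl, ENNReal.toReal_ofReal (by positivity)]

/-! ### Moments of the difference of two maxima -/

/-- The rescaled difference of the quantile functions of two independent Gaussian maxima. -/
noncomputable def quantileDiff (m n : ℕ) (p : ℝ × ℝ) : ℝ :=
  gaussianLevel m * (quantile (gaussianMax m) p.1 - quantile (gaussianMax n) p.2)

theorem quantileDiff_eq {m n : ℕ} (hn : gaussianLevel n ≠ 0) (p : ℝ × ℝ) :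
    quantileDiff m n p = scaledQuantile m p.1 -
      gaussianLevel m / gaussianLevel n * scaledQuantile n p.2 +
        gaussianLevel m * (gaussianLevel m - gaussianLevel n) := by
  rw [quantileDiff, scaledQuantile, scaledQuantile]
  field_simp
  ring

theorem aemeasurable_quantileDiff (m n : ℕ) :
    AEMeasurable (quantileDiff m n) (uniform01.prod uniform01) :=
  (((aemeasurable_quantile _).comp_quasiMeasurePreserving Measure.quasiMeasurePreserving_fst).sub
    ((aemeasurable_quantile _).comp_quasiMeasurePreserving
      Measure.quasiMeasurePreserving_snd)).const_mul _

theorem ae_uniform01_prod {p : ℝ × ℝ → Prop}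
    (h : ∀ u ∈ Set.Ioo (0 : ℝ) 1, ∀ v ∈ Set.Ioo (0 : ℝ) 1, p (u, v)) :
    ∀ᵐ q ∂(uniform01.prod uniform01), p q := by
  rw [uniform01, Measure.prod_restrict, ae_restrict_iff' (measurableSet_Ioo.prod measurableSet_Ioo)]
  exact .of_forall fun q hq => h q.1 hq.1 q.2 hq.2

/-- A bound with finite fourth moment for the rescaled differences of quantiles. -/
noncomputable def quantileDiffBound (p : ℝ × ℝ) : ℝ :=
  quantileBound p.1 + 2 * quantileBound p.2 + 1

theorem memLp_quantileDiffBound : MemLp quantileDiffBound 4 (uniform01.prod uniform01) :=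
  ((memLp_quantileBound.comp_measurePreserving measurePreserving_fst).add
    ((memLp_quantileBound.comp_measurePreserving measurePreserving_snd).const_mul 2)).add
      (memLp_const 1)

theorem eventually_abs_quantileDiff_le {m n : ℕ → ℕ} (hm : Tendsto m atTop atTop)
    (hn : Tendsto n atTop atTop) (h : Tendsto (fun k => (m k : ℝ) / n k) atTop (𝓝 1)) :
    ∀ᶠ k in atTop, ∀ᵐ p ∂(uniform01.prod uniform01),
      |quantileDiff (m k) (n k) p| ≤ quantileDiffBound p := by
  obtain ⟨h1, h2⟩ := tendsto_gaussianLevel_sub hm hn h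
  filter_upwards [hm.eventually_ge_atTop 2, hn.eventually_ge_atTop 2,
    (tendsto_gaussianLevel.comp hm).eventually_gt_atTop 0,
    (tendsto_gaussianLevel.comp hn).eventually_gt_atTop 0,
    -- The level ratio below `2` and the offset below `1` are the source of the two constants in
    -- `quantileDiffBound`.
    h1.eventually (gt_mem_nhds one_lt_two),
    (abs_zero (α := ℝ) ▸ h2.abs).eventually (gt_mem_nhds one_pos)]
    with k hm2 hn2 hbm hbn hr hd
  refine ae_uniform01_prod fun u hu v hv => ?_
  have hbm' : 0 < gaussianLevel (m k) := hbm
  have hbn' : 0 < gaussianLevel (n k) := hbn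
  rw [quantileDiff_eq hbn'.ne', quantileDiffBound]
  refine (abs_add_le _ _).trans (add_le_add ((abs_sub _ _).trans (add_le_add
    (abs_scaledQuantile_le hm2 hbm' hu) ?_)) hd.le)
  rw [abs_mul, abs_of_pos (div_pos hbm' hbn')]
  exact mul_le_mul hr.le (abs_scaledQuantile_le hn2 hbn' hv) (abs_nonneg _) zero_le_two

theorem tendsto_quantileDiff {m n : ℕ → ℕ} (hm : Tendsto m atTop atTop)
    (hn : Tendsto n atTop atTop) (h : Tendsto (fun k => (m k : ℝ) / n k) atTop (𝓝 1)) :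
    ∀ᵐ p ∂(uniform01.prod uniform01), Tendsto (fun k => quantileDiff (m k) (n k) p) atTop
      (𝓝 (gumbelQuantile p.1 - gumbelQuantile p.2)) := by
  obtain ⟨h1, h2⟩ := tendsto_gaussianLevel_sub hm hn h
  refine ae_uniform01_prod fun u hu v hv => ?_
  have h3 := (((tendsto_scaledQuantile hu).comp hm).sub
    (h1.mul ((tendsto_scaledQuantile hv).comp hn))).add h2
  rw [one_mul, add_zero] at h3
  refine h3.congr' ?_
  filter_upwards [(tendsto_gaussianLevel.comp hn).eventually_gt_atTop 0] with k hk
  exact (quantileDiff_eq (m := m k) (ne_of_gt hk) (u, v)).symm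

theorem tendsto_integral_quantileDiff_sq {m n : ℕ → ℕ} (hm : Tendsto m atTop atTop)
    (hn : Tendsto n atTop atTop) (h : Tendsto (fun k => (m k : ℝ) / n k) atTop (𝓝 1)) :
    Tendsto (fun k => ∫ p, quantileDiff (m k) (n k) p ^ 2 ∂(uniform01.prod uniform01)) atTop
      (𝓝 (Real.pi ^ 2 / 3)) := by
  rw [← integral_gumbelQuantile_sub_sq]
  refine tendsto_integral_filter_of_dominated_convergence (fun p => quantileDiffBound p ^ 2)
    (.of_forall fun k => ((aemeasurable_quantileDiff _ _).pow_const 2).aestronglyMeasurable) ?_ ?_ ?_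
  · filter_upwards [eventually_abs_quantileDiff_le hm hn h] with k hk
    filter_upwards [hk] with p hp
    rw [Real.norm_eq_abs, abs_pow]
    gcongr
  · exact (memLp_quantileDiffBound.mono_exponent (by norm_num)).integrable_sq
  · filter_upwards [tendsto_quantileDiff hm hn h] with p hp
    exact hp.pow 2

theorem eventually_integral_quantileDiff_pow_four_le {m n : ℕ → ℕ} (hm : Tendsto m atTop atTop)
    (hn : Tendsto n atTop atTop) (h : Tendsto (fun k => (m k : ℝ) / n k) atTop (𝓝 1)) :
    ∃ K, ∀ᶠ k in atTop,
      Integrable (fun p => quantileDiff (m k) (n k) p ^ 2) (uniform01.prod uniform01) ∧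
      Integrable (fun p => quantileDiff (m k) (n k) p ^ 4) (uniform01.prod uniform01) ∧
      ∫ p, quantileDiff (m k) (n k) p ^ 4 ∂(uniform01.prod uniform01) ≤ K := by
  have h4 : Integrable (fun p => quantileDiffBound p ^ 4) (uniform01.prod uniform01) := by
    have := memLp_quantileDiffBound.integrable_norm_pow (p := 4) (by norm_num)
    refine this.congr (.of_forall fun p => ?_)
    simp only [Real.norm_eq_abs]
    exact Even.pow_abs ⟨2, rfl⟩ _
  refine ⟨∫ p, quantileDiffBound p ^ 4 ∂(uniform01.prod uniform01), ?_⟩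
  filter_upwards [eventually_abs_quantileDiff_le hm hn h] with k hk
  have hle : ∀ᵐ p ∂(uniform01.prod uniform01),
      quantileDiff (m k) (n k) p ^ 4 ≤ quantileDiffBound p ^ 4 := by
    filter_upwards [hk] with p hp
    rw [← Even.pow_abs ⟨2, rfl⟩]
    gcongr
  have hi : Integrable (fun p => quantileDiff (m k) (n k) p ^ 4) (uniform01.prod uniform01) := by
    refine h4.mono' ((aemeasurable_quantileDiff _ _).pow_const 4).aestronglyMeasurable ?_
    filter_upwards [hle] with p hp
    rwa [Real.norm_of_nonneg (by positivity)]
  refine ⟨?_, hi, integral_mono_ae hi h4 hle⟩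
  refine (memLp_quantileDiffBound.mono_exponent (by norm_num)).integrable_sq.mono'
    ((aemeasurable_quantileDiff _ _).pow_const 2).aestronglyMeasurable ?_
  filter_upwards [hk] with p hp
  rw [Real.norm_eq_abs, abs_pow]
  gcongr

/-- A uniform bound on the fourth moments makes the integrals of the squares over events of
vanishing probability vanish. -/
theorem tendsto_setIntegral_sq_zero {Ω : ℕ → Type*} [∀ k, MeasurableSpace (Ω k)]
    {P : ∀ k, Measure (Ω k)} [∀ k, IsProbabilityMeasure (P k)] {D : ∀ k, Ω k → ℝ}
    {A : ∀ k, Set (Ω k)} {K : ℝ}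
    (h2 : ∀ᶠ k in atTop, Integrable (fun ω => D k ω ^ 2) (P k))
    (h4 : ∀ᶠ k in atTop, Integrable (fun ω => D k ω ^ 4) (P k) ∧ ∫ ω, D k ω ^ 4 ∂(P k) ≤ K)
    (hA : Tendsto (fun k => (P k).real (A k)) atTop (𝓝 0)) :
    Tendsto (fun k => ∫ ω in A k, D k ω ^ 2 ∂(P k)) atTop (𝓝 0) := by
  refine tendsto_order.2 ⟨fun a ha => .of_forall fun k =>
    ha.trans_le (integral_nonneg fun ω => sq_nonneg _), fun ε hε => ?_⟩
  -- The estimate rests on `D² ≤ δ D⁴ + 1 / (4 δ)`: `δ` makes the first term small, then a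
  -- probability below `2 δ ε` makes the second less than `ε / 2`.
  obtain ⟨δ, hδ, hδK⟩ : ∃ δ > 0, δ * K < ε / 2 := by
    refine ⟨ε / (2 * (|K| + 1)), by positivity, ?_⟩
    rw [div_mul_eq_mul_div, div_lt_div_iff₀ (by positivity) two_pos]
    nlinarith [le_abs_self K]
  have hsmall : ∀ᶠ k in atTop, (P k).real (A k) < 2 * δ * ε :=
    hA.eventually (gt_mem_nhds (by positivity))
  filter_upwards [h2, h4, hsmall] with k hk2 hk4 hk
  have hi : IntegrableOn (fun ω => δ * D k ω ^ 4 + 1 / (4 * δ)) (A k) (P k) :=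
    ((hk4.1.const_mul δ).integrableOn).add (integrable_const _)
  calc ∫ ω in A k, D k ω ^ 2 ∂(P k)
      ≤ ∫ ω in A k, (δ * D k ω ^ 4 + 1 / (4 * δ)) ∂(P k) := by
        refine integral_mono hk2.integrableOn hi fun ω => ?_
        have : δ * D k ω ^ 4 + 1 / (4 * δ) - D k ω ^ 2 =
            (2 * δ * D k ω ^ 2 - 1) ^ 2 / (4 * δ) := by field_simp; ring
        have : 0 ≤ δ * D k ω ^ 4 + 1 / (4 * δ) - D k ω ^ 2 := by rw [this]; positivity
        simpa using this
    _ = δ * ∫ ω in A k, D k ω ^ 4 ∂(P k) + (P k).real (A k) * (1 / (4 * δ)) := by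
        rw [integral_add ((hk4.1.const_mul δ).integrableOn) (integrable_const _),
          integral_const_mul, setIntegral_const, smul_eq_mul]
    _ ≤ δ * K + (P k).real (A k) * (1 / (4 * δ)) := by
        gcongr
        exact (setIntegral_le_integral hk4.1 (.of_forall fun ω => by positivity)).trans hk4.2
    _ < ε / 2 + 2 * δ * ε * (1 / (4 * δ)) := by gcongr
    _ = ε := by field_simp; ring

theorem tendsto_setIntegral_sq {Ω : ℕ → Type*} [∀ k, MeasurableSpace (Ω k)]
    {P : ∀ k, Measure (Ω k)} [∀ k, IsProbabilityMeasure (P k)] {D : ∀ k, Ω k → ℝ}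
    {A : ∀ k, Set (Ω k)} {m n : ℕ → ℕ} (hm : Tendsto m atTop atTop) (hn : Tendsto n atTop atTop)
    (h : Tendsto (fun k => (m k : ℝ) / n k) atTop (𝓝 1))
    (hD : ∀ k, IdentDistrib (D k) (quantileDiff (m k) (n k)) (P k) (uniform01.prod uniform01))
    (hAm : ∀ᶠ k in atTop, NullMeasurableSet (A k) (P k))
    (hA : Tendsto (fun k => P k (A k)) atTop (𝓝 1)) :
    Tendsto (fun k => ∫ ω in A k, D k ω ^ 2 ∂(P k)) atTop (𝓝 (Real.pi ^ 2 / 3)) := by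
  obtain ⟨K, hK⟩ := eventually_integral_quantileDiff_pow_four_le hm hn h
  have hp : ∀ k (i : ℕ), IdentDistrib (fun ω => D k ω ^ i) (fun p => quantileDiff (m k) (n k) p ^ i)
      (P k) (uniform01.prod uniform01) := fun k i => (hD k).comp (measurable_id.pow_const i)
  have h2 : ∀ᶠ k in atTop, Integrable (fun ω => D k ω ^ 2) (P k) :=
    hK.mono fun k hk => (hp k 2).integrable_iff.2 hk.1
  have hAr : Tendsto (fun k => (P k).real (A k)) atTop (𝓝 1) := by
    exact (ENNReal.tendsto_toReal ENNReal.one_ne_top).comp hA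
  have hAc : Tendsto (fun k => (P k).real (A k)ᶜ) atTop (𝓝 0) := by
    have : Tendsto (fun k => 1 - (P k).real (A k)) atTop (𝓝 0) := by
      simpa using hAr.const_sub 1
    refine this.congr' (hAm.mono fun k hk => ?_)
    simp only [measureReal_def]
    rw [prob_compl_eq_one_sub₀ hk,
      ENNReal.toReal_sub_of_le prob_le_one ENNReal.one_ne_top, ENNReal.toReal_one]
  have h0 := tendsto_setIntegral_sq_zero h2 (hK.mono fun k hk =>
    ⟨(hp k 4).integrable_iff.2 hk.2.1, (hp k 4).integral_eq.trans_le hk.2.2⟩) hAc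
  have h1 := (tendsto_integral_quantileDiff_sq hm hn h).sub h0
  rw [sub_zero] at h1
  refine h1.congr' ?_
  filter_upwards [h2, hAm] with k hk hkm
  rw [← (hp k 2).integral_eq, ← integral_add_compl₀ hkm hk, add_sub_cancel_right]

/-! ### Laws and independence of the maximal projections -/

theorem hasLaw_gaussianMax {Ω : Type*} [MeasurableSpace Ω] {P : Measure Ω} [IsProbabilityMeasure P]
    {n : ℕ} {Z : Fin n → Ω → ℝ} (hZ : ∀ i, HasLaw (Z i) (gaussianReal 0 1) P)
    (hind : iIndepFun Z P) : HasLaw (fun ω => ⨆ i, Z i ω) (gaussianMax n) P := by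
  have hm : AEMeasurable (fun ω i => Z i ω) P :=
    aemeasurable_pi_lambda _ fun i => (hZ i).aemeasurable
  refine ⟨(measurable_iSup_apply n).comp_aemeasurable hm, ?_⟩
  have h := hind.map_fun_eq_pi_map fun i => (hZ i).aemeasurable
  simp only [(hZ _).map_eq] at h
  rw [gaussianMax, ← h,
    AEMeasurable.map_map_of_aemeasurable (measurable_iSup_apply n).aemeasurable hm]
  rfl

/-- Independence determines the joint law from the marginals. All networks, each on its own
probability space, are thus compared on one fixed space, where dominated convergence applies. -/
theorem identDistrib_quantileDiff {Ω : Type*} [MeasurableSpace Ω] {P : Measure Ω}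
    [IsProbabilityMeasure P] {m n : ℕ} {X Y : Ω → ℝ} (hX : HasLaw X (gaussianMax m) P)
    (hY : HasLaw Y (gaussianMax n) P) (hXY : IndepFun X Y P) :
    IdentDistrib (fun ω => gaussianLevel m * (X ω - Y ω)) (quantileDiff m n) P
      (uniform01.prod uniform01) := by
  have hq : ∀ l, HasLaw (quantile (gaussianMax l)) (gaussianMax l) uniform01 := fun l =>
    ⟨aemeasurable_quantile _, map_quantile_uniform01 _⟩
  have h1 := (hq m).fun_comp
    (measurePreserving_fst (μ := uniform01) (ν := uniform01)).hasLaw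
  have h2 := (hq n).fun_comp
    (measurePreserving_snd (μ := uniform01) (ν := uniform01)).hasLaw
  have hind := indepFun_prod₀ (aemeasurable_quantile (gaussianMax m))
    (aemeasurable_quantile (gaussianMax n))
  have hpair : IdentDistrib (fun ω => (X ω, Y ω))
      (fun p : ℝ × ℝ => (quantile (gaussianMax m) p.1, quantile (gaussianMax n) p.2)) P
      (uniform01.prod uniform01) := by
    refine ⟨hX.aemeasurable.prodMk hY.aemeasurable, h1.aemeasurable.prodMk h2.aemeasurable, ?_⟩
    rw [hXY.map_prod_eq_prod_map_map hX.aemeasurable hY.aemeasurable,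
      hind.map_prod_eq_prod_map_map h1.aemeasurable h2.aemeasurable, hX.map_eq, hY.map_eq,
      h1.map_eq, h2.map_eq]
  exact hpair.comp (u := fun p : ℝ × ℝ => gaussianLevel m * (p.1 - p.2)) (by fun_prop)

theorem abs_iSup_le_sum {n : ℕ} (x : Fin n → ℝ) : |⨆ i, x i| ≤ ∑ i, |x i| := by
  rcases isEmpty_or_nonempty (Fin n) with h | h
  · simp [Real.iSup_of_isEmpty]
  · obtain ⟨i, hi⟩ := exists_eq_ciSup_of_finite (f := x)
    rw [← hi]
    exact Finset.single_le_sum (f := fun i => |x i|) (fun _ _ => abs_nonneg _) (Finset.mem_univ i)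

/-- A crude bound by the sum of absolute values; it gives integrability for every `n`, whereas the
quantile bounds need large `n`. -/
theorem memLp_id_gaussianMax (n : ℕ) : MemLp id 2 (gaussianMax n) := by
  rw [gaussianMax, memLp_map_measure_iff aestronglyMeasurable_id
    (measurable_iSup_apply n).aemeasurable]
  have h : MemLp (fun x : Fin n → ℝ => ∑ i, |x i|) 2 (Measure.pi fun _ => gaussianReal 0 1) :=
    memLp_finsetSum _ fun i _ => ((memLp_id_gaussianReal' 2 (by simp)).comp_measurePreserving
      (measurePreserving_eval (fun _ : Fin n => gaussianReal 0 1) i)).abs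
  refine h.mono (measurable_iSup_apply n).aestronglyMeasurable (.of_forall fun x => ?_)
  exact (abs_iSup_le_sum x).trans (le_abs_self _)

/-- Each projection is a single coordinate up to sign, so only the diagonal of `C` matters and the
two coordinates may be correlated. -/
theorem hasLaw_inner_roadNormal_div {Ω : Type*} [MeasurableSpace Ω] {P : Measure Ω} {Y : Ω → Plane}
    {C : Matrix (Fin 2) (Fin 2) ℝ} {σ : ℝ} (hσ : 0 < σ) (hC : C.PosSemidef)
    (hCσ : ∀ a, C a a = σ ^ 2) (hY : HasLaw Y (multivariateGaussian 0 C) P) (j : Fin 4) :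
    HasLaw (fun ω => inner ℝ (Y ω) (roadNormal (orthAngle j)) / σ) (gaussianReal 0 1) P := by
  have key : ∀ (i : Fin 2) (c : ℝ), c ^ 2 = 1 →
      HasLaw (fun ω => c / σ * Y ω i) (gaussianReal 0 1) P := fun i c hc => by
    have h1 := (measurePreserving_eval_multivariateGaussian (μ := 0) hC (i := i)).fun_comp_hasLaw hY
    have h2 := gaussianReal_const_mul h1 (c / σ)
    have hv : NNReal.mk ((c / σ) ^ 2) (sq_nonneg _) * (C i i).toNNReal = 1 := by
      ext
      rw [NNReal.coe_mul, hCσ, Real.coe_toNNReal _ (sq_nonneg _)]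
      simp only [NNReal.coe_mk, NNReal.coe_one]
      rw [div_pow, hc]
      field_simp
    rw [hv, PiLp.zero_apply, mul_zero] at h2
    exact h2
  fin_cases j
  · change HasLaw (fun ω => inner ℝ (Y ω) (roadNormal (orthAngle 0)) / σ) _ P
    simp only [inner_roadNormal_zero]
    convert key 1 (-1) (by norm_num) using 2
    ring
  · change HasLaw (fun ω => inner ℝ (Y ω) (roadNormal (orthAngle 1)) / σ) _ P
    simp only [inner_roadNormal_one]
    convert key 0 1 (by norm_num) using 2
    ring
  · change HasLaw (fun ω => inner ℝ (Y ω) (roadNormal (orthAngle 2)) / σ) _ P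
    simp only [inner_roadNormal_two]
    convert key 1 1 (by norm_num) using 2
    ring
  · change HasLaw (fun ω => inner ℝ (Y ω) (roadNormal (orthAngle 3)) / σ) _ P
    simp only [inner_roadNormal_three]
    convert key 0 (-1) (by norm_num) using 2
    ring

theorem maxProjection_div_eq_iSup {N : Fin 4 → ℕ} (V : VehicleNetwork (OrthVehicle N)) {σ : ℝ}
    (hσ : 0 < σ) (j : Fin 4) :
    maxProjection V j / σ =
      ⨆ i : Fin (N j), inner ℝ (V.composite ⟨j, i⟩) (roadNormal (orthAngle j)) / σ := by
  simp_rw [maxProjection, div_eq_mul_inv]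
  exact Real.iSup_mul_of_nonneg (inv_nonneg.2 hσ.le) _

theorem hasLaw_maxProjection_div {Ω : Type*} [MeasurableSpace Ω] {P : Measure Ω}
    [IsProbabilityMeasure P] {N : Fin 4 → ℕ} {σ : ℝ} {C : Matrix (Fin 2) (Fin 2) ℝ}
    {V : Ω → VehicleNetwork (OrthVehicle N)}
    (hσ : 0 < σ) (hC : C.PosSemidef) (hCσ : ∀ a, C a a = σ ^ 2)
    (hlaw : ∀ v, HasLaw (fun ω => (V ω).composite v) (multivariateGaussian 0 C) P)
    (hind : iIndepFun (fun v ω => (V ω).composite v) P) (j : Fin 4) :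
    HasLaw (fun ω => maxProjection (V ω) j / σ) (gaussianMax (N j)) P := by
  simp only [maxProjection_div_eq_iSup _ hσ]
  refine hasLaw_gaussianMax (fun i => hasLaw_inner_roadNormal_div hσ hC hCσ (hlaw ⟨j, i⟩) j) ?_
  exact (hind.precomp (g := Sigma.mk j) sigma_mk_injective).comp
    (fun _ x => inner ℝ x (roadNormal (orthAngle j)) / σ) fun _ => by fun_prop

theorem indepFun_maxProjection_div {Ω : Type*} [MeasurableSpace Ω] {P : Measure Ω}
    {N : Fin 4 → ℕ} {σ : ℝ} {C : Matrix (Fin 2) (Fin 2) ℝ} {V : Ω → VehicleNetwork (OrthVehicle N)}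
    (hlaw : ∀ v, HasLaw (fun ω => (V ω).composite v) (multivariateGaussian 0 C) P)
    (hind : iIndepFun (fun v ω => (V ω).composite v) P) {i j : Fin 4} (hij : i ≠ j) :
    IndepFun (fun ω => maxProjection (V ω) i / σ) (fun ω => maxProjection (V ω) j / σ) P := by
  have h := hind.indepFun_finset₀ (Finset.univ.filter fun v => v.1 = i)
    (Finset.univ.filter fun v => v.1 = j)
    (Finset.disjoint_filter.2 fun v _ h1 h2 => hij (h1.symm.trans h2))
    fun v => (hlaw v).aemeasurable
  have hφ : ∀ k : Fin 4, Measurable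
      fun z : (Finset.univ.filter fun v : OrthVehicle N => v.1 = k) → Plane =>
        (⨆ a : Fin (N k), inner ℝ (z ⟨⟨k, a⟩, by simp⟩) (roadNormal (orthAngle k))) / σ :=
    fun k => (Measurable.iSup fun a => by fun_prop).div_const σ
  exact h.comp (hφ i) (hφ j)

theorem memLp_maxProjection {Ω : Type*} [MeasurableSpace Ω] {P : Measure Ω}
    [IsProbabilityMeasure P] {N : Fin 4 → ℕ} {σ : ℝ} {C : Matrix (Fin 2) (Fin 2) ℝ}
    {V : Ω → VehicleNetwork (OrthVehicle N)}
    (hσ : 0 < σ) (hC : C.PosSemidef) (hCσ : ∀ a, C a a = σ ^ 2)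
    (hlaw : ∀ v, HasLaw (fun ω => (V ω).composite v) (multivariateGaussian 0 C) P)
    (hind : iIndepFun (fun v ω => (V ω).composite v) P) (j : Fin 4) :
    MemLp (fun ω => maxProjection (V ω) j) 2 P := by
  have h := hasLaw_maxProjection_div hσ hC hCσ hlaw hind j
  have h1 : MemLp (fun ω => maxProjection (V ω) j / σ) 2 P := by
    have := memLp_id_gaussianMax (N j)
    rw [← h.map_eq, memLp_map_measure_iff aestronglyMeasurable_id h.aemeasurable] at this
    exact this
  have h2 : (fun ω => maxProjection (V ω) j) = fun ω => σ * (maxProjection (V ω) j / σ) := by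
    ext ω; field_simp
  rw [h2]
  exact h1.const_mul σ

/-! ### Assembly of the asymptotics -/

theorem orthSquareError_eq (X : Fin 4 → ℝ) :
    orthSquareError X = 1 / 4 * ((X 0 - X 2) ^ 2 + (X 1 - X 3) ^ 2) := by
  rw [orthSquareError, Fin.sum_univ_four]; ring

/-- Both levels satisfy `b² ~ 2 log` and have ratio tending to one, so each summand tends to `2`.
This replaces the single scale `b_m` by an expression symmetric in the two directions. -/
theorem tendsto_inv_mul_log_sum {m n : ℕ → ℕ} (hm : Tendsto m atTop atTop)
    (hn : Tendsto n atTop atTop) (h : Tendsto (fun k => (m k : ℝ) / n k) atTop (𝓝 1)) :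
    Tendsto (fun k => gaussianLevel (m k) ^ 2 * (1 / Real.log (m k) + 1 / Real.log (n k))) atTop
      (𝓝 4) := by
  have h1 : ∀ {l : ℕ → ℕ}, Tendsto l atTop atTop →
      Tendsto (fun k => gaussianLevel (l k) ^ 2 / Real.log (l k)) atTop (𝓝 2) := fun {l} hl => by
    have := (tendsto_log_div_gaussianLevel_sq.comp hl).inv₀ (by norm_num)
    simpa using this
  have h2 := (h1 hm).add ((((tendsto_gaussianLevel_sub hm hn h).1).pow 2).mul (h1 hn))
  norm_num at h2
  refine h2.congr' ?_
  filter_upwards [(tendsto_gaussianLevel.comp hn).eventually_gt_atTop 0] with k hk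
  have hk' : gaussianLevel (n k) ≠ 0 := ne_of_gt hk
  field_simp

theorem isEquivalent_setIntegral_sub_sq {Ω : ℕ → Type*} [∀ k, MeasurableSpace (Ω k)]
    {P : ∀ k, Measure (Ω k)} [∀ k, IsProbabilityMeasure (P k)] {X Y : ∀ k, Ω k → ℝ}
    {A : ∀ k, Set (Ω k)} {m n : ℕ → ℕ} {σ : ℕ → ℝ} (hm : Tendsto m atTop atTop)
    (hn : Tendsto n atTop atTop) (h : Tendsto (fun k => (m k : ℝ) / n k) atTop (𝓝 1))
    (hσ : ∀ k, 0 < σ k)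
    (hX : ∀ k, HasLaw (fun ω => X k ω / σ k) (gaussianMax (m k)) (P k))
    (hY : ∀ k, HasLaw (fun ω => Y k ω / σ k) (gaussianMax (n k)) (P k))
    (hXY : ∀ k, IndepFun (fun ω => X k ω / σ k) (fun ω => Y k ω / σ k) (P k))
    (hAm : ∀ᶠ k in atTop, NullMeasurableSet (A k) (P k))
    (hA : Tendsto (fun k => P k (A k)) atTop (𝓝 1)) :
    (fun k => ∫ ω in A k, (X k ω - Y k ω) ^ 2 ∂(P k)) ~[atTop]
      fun k => Real.pi ^ 2 * σ k ^ 2 / 12 * (1 / Real.log (m k) + 1 / Real.log (n k)) := by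
  have h1 := tendsto_setIntegral_sq hm hn h
    (fun k => identDistrib_quantileDiff (hX k) (hY k) (hXY k)) hAm hA
  have hlog : ∀ {l : ℕ → ℕ}, Tendsto l atTop atTop → ∀ᶠ k in atTop, 0 < Real.log (l k) :=
    fun hl => (Real.tendsto_log_atTop.comp
      (tendsto_natCast_atTop_atTop.comp hl)).eventually_gt_atTop 0
  have hpos : ∀ᶠ k in atTop, 0 < 1 / Real.log (m k) + 1 / Real.log (n k) := by
    filter_upwards [hlog hm, hlog hn] with k h1 h2
    positivity
  rw [isEquivalent_iff_tendsto_one]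
  · have h2 := h1.div ((tendsto_inv_mul_log_sum hm hn h).const_mul (Real.pi ^ 2 / 12))
      (by positivity)
    have h3 : Real.pi ^ 2 / 3 / (Real.pi ^ 2 / 12 * 4) = 1 := by
      have := Real.pi_ne_zero
      field_simp; norm_num
    rw [h3] at h2
    refine h2.congr' ?_
    filter_upwards [hpos, (tendsto_gaussianLevel.comp hm).eventually_gt_atTop 0] with k hk hb
    have hb' : 0 < gaussianLevel (m k) := hb
    have hσk := hσ k
    have h4 : ∫ ω in A k, (X k ω - Y k ω) ^ 2 ∂(P k) = σ k ^ 2 / gaussianLevel (m k) ^ 2 *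
        ∫ ω in A k, (gaussianLevel (m k) * (X k ω / σ k - Y k ω / σ k)) ^ 2 ∂(P k) := by
      rw [← integral_const_mul]
      congr 1
      ext ω
      field_simp
    simp only [Pi.div_apply]
    rw [h4]
    generalize (∫ ω in A k, (gaussianLevel (m k) * (X k ω / σ k - Y k ω / σ k)) ^ 2 ∂(P k)) = I
    generalize (1 / Real.log (m k) + 1 / Real.log (n k)) = J at hk
    have := Real.pi_ne_zero
    field_simp
  · filter_upwards [hpos] with k hk
    have := Real.pi_pos
    have := hσ k
    positivity

theorem integrable_orthSquareError {Ω : Type*} [MeasurableSpace Ω] {P : Measure Ω}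
    {X : Ω → Fin 4 → ℝ}
    (hX : ∀ j, MemLp (fun ω => X ω j) 2 P) : Integrable (fun ω => orthSquareError (X ω)) P := by
  simp only [orthSquareError_eq]
  exact ((((hX 0).sub (hX 2)).integrable_sq).add (((hX 1).sub (hX 3)).integrable_sq)).const_mul _

theorem isEquivalent_setIntegral_orthSquareError {Ω : ℕ → Type*} [∀ k, MeasurableSpace (Ω k)]
    {P : ∀ k, Measure (Ω k)} [∀ k, IsProbabilityMeasure (P k)] {X : ∀ k, Ω k → Fin 4 → ℝ}
    {A : ∀ k, Set (Ω k)} {N : ℕ → Fin 4 → ℕ} {σ : ℕ → ℝ}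
    (hN : ∀ j, Tendsto (fun k => N k j) atTop atTop)
    (h02 : Tendsto (fun k => (N k 0 : ℝ) / (N k 2 : ℝ)) atTop (𝓝 1))
    (h13 : Tendsto (fun k => (N k 1 : ℝ) / (N k 3 : ℝ)) atTop (𝓝 1))
    (hσ : ∀ k, 0 < σ k)
    (hX2 : ∀ k j, MemLp (fun ω => X k ω j) 2 (P k))
    (hX : ∀ k j, HasLaw (fun ω => X k ω j / σ k) (gaussianMax (N k j)) (P k))
    (hind : ∀ k i j, i ≠ j → IndepFun (fun ω => X k ω i / σ k) (fun ω => X k ω j / σ k) (P k))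
    (hAm : ∀ᶠ k in atTop, NullMeasurableSet (A k) (P k))
    (hA : Tendsto (fun k => P k (A k)) atTop (𝓝 1)) :
    (fun k => ∫ ω in A k, orthSquareError (X k ω) ∂(P k)) ~[atTop]
      fun k => Real.pi ^ 2 * σ k ^ 2 / 48 * ∑ j, 1 / Real.log (N k j) := by
  have e1 := isEquivalent_setIntegral_sub_sq (hN 0) (hN 2) h02 hσ (fun k => hX k 0)
    (fun k => hX k 2) (fun k => hind k 0 2 (by decide)) hAm hA
  have e2 := isEquivalent_setIntegral_sub_sq (hN 1) (hN 3) h13 hσ (fun k => hX k 1)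
    (fun k => hX k 3) (fun k => hind k 1 3 (by decide)) hAm hA
  -- Equivalences may be added because no cancellation is possible between nonnegative comparison
  -- sequences. Only linearity of the integral is used across the two pairs.
  have hnn : ∀ (a b : ℕ → ℕ), 0 ≤ fun k =>
      Real.pi ^ 2 * σ k ^ 2 / 12 * (1 / Real.log (a k) + 1 / Real.log (b k)) := fun a b k => by
    have := Real.log_natCast_nonneg (a k)
    have := Real.log_natCast_nonneg (b k)
    show (0 : ℝ) ≤ _
    positivity
  have e3 := (IsEquivalent.refl (u := fun _ : ℕ => (1 / 4 : ℝ)) (l := atTop)).mul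
    (e1.add_add_of_nonneg (hnn _ _) (hnn _ _) e2)
  refine (e3.congr_left (.of_forall fun k => ?_)).congr_right (.of_forall fun k => ?_)
  · have hi : ∀ i j, Integrable (fun ω => (X k ω i - X k ω j) ^ 2) ((P k).restrict (A k)) :=
      fun i j => (((hX2 k i).sub (hX2 k j)).integrable_sq).restrict
    simp only [orthSquareError_eq, Pi.mul_apply, Pi.add_apply]
    rw [integral_const_mul, integral_add (hi 0 2) (hi 1 3)]
  · simp only [Pi.mul_apply, Pi.add_apply]
    rw [Fin.sum_univ_four]
    ring

theorem mainTheorem3 :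
    -- the exact expression of the squared error, for all values of the errors
    (∀ (N : Fin 4 → ℕ) (w : ℝ) (V : VehicleNetwork (OrthVehicle N)),
      (∀ j, 0 < N j) → (V.feasibleSet orthNormal w).Nonempty →
        0 < volume (V.feasibleSet orthNormal w) ∧ volume (V.feasibleSet orthNormal w) < ⊤ ∧
        ‖V.cmmError orthNormal w‖ ^ 2 = orthSquareError (maxProjection V)) ∧
    -- the asymptotics of its expectation, along an arbitrary sequence of networks
    (∀ (Ω : ℕ → Type*) [∀ k, MeasurableSpace (Ω k)]
      (P : ∀ k, Measure (Ω k)) [∀ k, IsProbabilityMeasure (P k)]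
      (N : ℕ → Fin 4 → ℕ) (w σ : ℕ → ℝ) (C : ℕ → Matrix (Fin 2) (Fin 2) ℝ)
      (V : ∀ k, Ω k → VehicleNetwork (OrthVehicle (N k))),
      (∀ j, Tendsto (fun k => N k j) atTop atTop) →
      Tendsto (fun k => (N k 0 : ℝ) / (N k 2 : ℝ)) atTop (𝓝 1) →
      Tendsto (fun k => (N k 1 : ℝ) / (N k 3 : ℝ)) atTop (𝓝 1) →
      (∀ k, 0 < σ k) →
      (∀ k, (C k).PosSemidef ∧ ∀ a, C k a a = σ k ^ 2) →
      (∀ k v, HasLaw (fun ω => (V k ω).composite v) (multivariateGaussian 0 (C k)) (P k)) →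
      (∀ k, iIndepFun (fun v ω => (V k ω).composite v) (P k)) →
        -- expectation of the expression with respect to the law of the maxima
        ((∀ k, Integrable (fun ω => orthSquareError (maxProjection (V k ω))) (P k)) ∧
          (fun k => ∫ ω, orthSquareError (maxProjection (V k ω)) ∂(P k)) ~[atTop]
            (fun k => Real.pi ^ 2 * σ k ^ 2 / 48 * ∑ j, 1 / Real.log (N k j))) ∧
        -- expectation of the squared error itself, given that it is defined, when the errors are
        -- so small compared with the lane width that it is defined with probability close to one
        (Tendsto (fun k => P k {ω | ((V k ω).feasibleSet orthNormal (w k)).Nonempty})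
            atTop (𝓝 1) →
          (∀ᶠ k in atTop, Integrable (fun ω => ‖(V k ω).cmmError orthNormal (w k)‖ ^ 2)
            (cond (P k) {ω | ((V k ω).feasibleSet orthNormal (w k)).Nonempty})) ∧
          (fun k => ∫ ω, ‖(V k ω).cmmError orthNormal (w k)‖ ^ 2
              ∂(cond (P k) {ω | ((V k ω).feasibleSet orthNormal (w k)).Nonempty})) ~[atTop]
            (fun k => Real.pi ^ 2 * σ k ^ 2 / 48 * ∑ j, 1 / Real.log (N k j)))) := by
  refine ⟨fun N w V hN hne => ⟨V.volume_feasibleSet_pos w hN hne,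
    (V.isBounded_feasibleSet w hN).measure_lt_top, V.norm_cmmError_sq w hN hne⟩, ?_⟩
  intro Ω _ P _ N w σ C V hN h02 h13 hσ hC hlaw hind
  have hX2 : ∀ k j, MemLp (fun ω => maxProjection (V k ω) j) 2 (P k) := fun k j =>
    memLp_maxProjection (hσ k) (hC k).1 (hC k).2 (hlaw k) (hind k) j
  have hX : ∀ k j, HasLaw (fun ω => maxProjection (V k ω) j / σ k) (gaussianMax (N k j)) (P k) :=
    fun k j => hasLaw_maxProjection_div (hσ k) (hC k).1 (hC k).2 (hlaw k) (hind k) j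
  have hXind : ∀ k i j, i ≠ j → IndepFun (fun ω => maxProjection (V k ω) i / σ k)
      (fun ω => maxProjection (V k ω) j / σ k) (P k) := fun k i j hij =>
    indepFun_maxProjection_div (hlaw k) (hind k) hij
  have hint : ∀ k, Integrable (fun ω => orthSquareError (maxProjection (V k ω))) (P k) :=
    fun k => integrable_orthSquareError (hX2 k)
  refine ⟨⟨hint, ?_⟩, fun hF => ?_⟩
  · have := isEquivalent_setIntegral_orthSquareError (A := fun _ => Set.univ) hN h02 h13 hσ hX2 hX
      hXind (.of_forall fun k => nullMeasurableSet_univ) (by simp)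
    simpa only [Measure.restrict_univ] using this
  set F : ∀ k, Set (Ω k) := fun k => {ω | ((V k ω).feasibleSet orthNormal (w k)).Nonempty}
  have hNpos : ∀ᶠ k in atTop, ∀ j, 0 < N k j :=
    eventually_all.2 fun j => (hN j).eventually_gt_atTop 0
  -- Non-emptiness is two inequalities between maxima once every direction has a vehicle, hence
  -- measurable up to null sets for large `k`.
  have hFm : ∀ᶠ k in atTop, NullMeasurableSet (F k) (P k) := by
    filter_upwards [hNpos] with k hk
    have hFeq : F k = {ω | maxProjection (V k ω) 0 + maxProjection (V k ω) 2 < 2 * w k} ∩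
        {ω | maxProjection (V k ω) 1 + maxProjection (V k ω) 3 < 2 * w k} :=
      Set.ext fun ω => (V k ω).feasibleSet_nonempty_iff (w k) hk
    have hm : ∀ j, AEMeasurable (fun ω => maxProjection (V k ω) j) (P k) := fun j =>
      (hX2 k j).aestronglyMeasurable.aemeasurable
    rw [hFeq]
    exact (nullMeasurableSet_lt ((hm 0).add (hm 2)) aemeasurable_const).inter
      (nullMeasurableSet_lt ((hm 1).add (hm 3)) aemeasurable_const)
  have hae : ∀ᶠ k in atTop, (fun ω => orthSquareError (maxProjection (V k ω))) =ᵐ[cond (P k) (F k)]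
      fun ω => ‖(V k ω).cmmError orthNormal (w k)‖ ^ 2 := by
    filter_upwards [hNpos, hFm] with k hk hkm
    refine Measure.ae_smul_measure ?_ _
    filter_upwards [ae_restrict_mem₀ hkm] with ω hω
    exact ((V k ω).norm_cmmError_sq (w k) hk hω).symm
  have hne : ∀ᶠ k in atTop, P k (F k) ≠ 0 := hF.eventually_ne one_ne_zero
  constructor
  · filter_upwards [hae, hne] with k hk hk0
    exact ((hint k).restrict.smul_measure (ENNReal.inv_ne_top.2 hk0)).congr hk
  · have e1 := isEquivalent_setIntegral_orthSquareError hN h02 h13 hσ hX2 hX hXind hFm hF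
    -- Conditioning multiplies the integral over the event by this factor, which does not affect the
    -- equivalence.
    have hinv : Tendsto (fun k => ((P k (F k))⁻¹).toReal) atTop (𝓝 1) := by
      have := (ENNReal.tendsto_toReal (by simp)).comp hF.inv
      rwa [inv_one, ENNReal.toReal_one] at this
    have e2 := ((isEquivalent_const_iff_tendsto one_ne_zero).2 hinv).mul e1
    refine (e2.congr_left ?_).congr_right (.of_forall fun k => one_mul _)
    filter_upwards [hae] with k hk
    rw [← integral_congr_ae hk, ProbabilityTheory.cond, integral_smul_measure, smul_eq_mul]
    rfl
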